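/- Let $X_1,X_2,\dots$ be independent $\mathcal N(\mu,\sigma^2)$ random variables, $\mu\in\mathbb R$, $\sigma>0$. For $n\in\mathbb N$ let $\bar X=\frac1n\sum_{k=1}^n X_k$, $S_X^2=\frac1n\sum_{k=1}^n (X_k-\bar X)^2$, $\widehat\psi_X(t)=\frac1n\sum_{k=1}^n e^{itX_k}$ and $$\widehat\psi_X^*(t)=\exp\!\left(-it\,\frac{\bar X}{S_X}\right)\widehat\psi_X\!\left(\frac{t}{S_X}\right)$$ (with the convention $x/0=0$ on the event $S_X=0$, which has probability $0$ for $n\ge 2$ and is certain for $n=1$, so that $\widehat\psi_X^*\equiv 1$ there). Let $\psi_0(t)=e^{-t^2/2}$ and $U_n(t)=\sqrt n\,(\widehat\psi_X^*(t)-\psi_0(t))$. Fix $T>0$ and a bounded measurable function $w:[-T,T]\to\mathbb R$. For an integer $m\ge 1$ put $$S_m^{(n)}(t)=\left(\widehat\psi_X^*\!\left(\frac{t}{\sqrt m}\right)\right)^m,\qquad D_m^{(n)}(t)=S_{m+1}^{(n)}(t)-S_m^{(n)}(t),\qquad \Delta_m^{(n)}=\int_{-T}^{T} w(t)\,|D_m^{(n)}(t)|^2\,dt,$$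 $$H_m^{(n)}(t)=(m+1)\,\frac{U_n(t/\sqrt{m+1})}{\psi_0(t/\sqrt{m+1})}-m\,\frac{U_n(t/\sqrt m)}{\psi_0(t/\sqrt m)}.$$ Then, for each fixed $m\ge 1$, as $n\to\infty$, $$\Delta_m^{(n)}=\frac1n\int_{-T}^{T} w(t)\,\psi_0(t)^2\,|H_m^{(n)}(t)|^2\,dt+o_{\mathbb P}(n^{-1}),$$ and $\Delta_m^{(n)}=O_{\mathbb P}(n^{-1})$. Moreover, for every real $p\ge 1$, $$\sup_{n\in\mathbb N}\mathbb E\big[\,|n\Delta_m^{(n)}|^p\,\big]<\infty,$$ and the family $\{|n\Delta_m^{(n)}|^p : n\in\mathbb N\}$ is uniformly integrable. (If $w\ge 0$, then $\Delta_m^{(n)}\ge 0$ and the absolute values are redundant.) -/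

import Mathlib

noncomputable section

namespace SSTN

/-- The sample mean `x̄ = n⁻¹ ∑ x_k`. -/
def sampleMean {n : ℕ} (x : Fin n → ℝ) : ℝ :=
  (1 / (n : ℝ)) * ∑ k, x k

/-- The sample standard deviation, the square root of `n⁻¹ ∑ (x_k - x̄)²`. -/
def sampleSD {n : ℕ} (x : Fin n → ℝ) : ℝ :=
  Real.sqrt ((1 / (n : ℝ)) * ∑ k, (x k - sampleMean x) ^ 2)

/-- The empirical characteristic function `t ↦ n⁻¹ ∑ exp(i t x_k)`. -/
def ecf {n : ℕ} (x : Fin n → ℝ) (t : ℝ) : ℂ :=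
  (1 / (n : ℂ)) * ∑ k, Complex.exp (Complex.I * (t : ℂ) * (x k : ℂ))

/-- The standardized empirical characteristic function
`t ↦ exp(-i t x̄ / s) · ecf(t / s)`, with `s` the sample standard deviation. -/
def stdEcf {n : ℕ} (x : Fin n → ℝ) (t : ℝ) : ℂ :=
  Complex.exp (-(Complex.I * (t : ℂ) * ((sampleMean x / sampleSD x : ℝ) : ℂ))) *
    ecf x (t / sampleSD x)

/-- The characteristic function `exp(-t²/2)` of the standard normal distribution. -/
def psi0 (t : ℝ) : ℝ := Real.exp (-(t ^ 2) / 2)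

/-- The self-similarity operator `f ↦ (t ↦ f(t/√m)^m)`. -/
def selfSimOp (m : ℕ) (f : ℝ → ℂ) (t : ℝ) : ℂ :=
  f (t / Real.sqrt (m : ℝ)) ^ m

/-- The empirical self-similarity transform. -/
def selfSimTransform {n : ℕ} (m : ℕ) (x : Fin n → ℝ) : ℝ → ℂ :=
  selfSimOp m (stdEcf x)

/-- The iterative discrepancy `D_m = S_{m+1} - S_m`. -/
def iterDiscrepancy {n : ℕ} (m : ℕ) (x : Fin n → ℝ) (t : ℝ) : ℂ :=
  selfSimTransform (m + 1) x t - selfSimTransform m x t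

/-- The self-similarity discrepancy measure `Δ_m = ∫_{-T}^T w(t) |D_m(t)|² dt`. -/
def discrepancyMeasure {n : ℕ} (w : ℝ → ℝ) (T : ℝ) (m : ℕ) (x : Fin n → ℝ) : ℝ :=
  ∫ t in (-T)..T, w t * ‖iterDiscrepancy m x t‖ ^ 2

/-- The process `U_n(t) = √n (stdEcf(t) - ψ₀(t))`. -/
def scaledDeviation {n : ℕ} (x : Fin n → ℝ) (t : ℝ) : ℂ :=
  (Real.sqrt (n : ℝ) : ℂ) * (stdEcf x t - (psi0 t : ℂ))

/-- The transformed deviation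
`H_m(t) = (m+1) U_n(t/√(m+1)) / ψ₀(t/√(m+1)) - m U_n(t/√m) / ψ₀(t/√m)`. -/
def transformedDeviation {n : ℕ} (m : ℕ) (x : Fin n → ℝ) (t : ℝ) : ℂ :=
  ((m : ℂ) + 1) * (scaledDeviation x (t / Real.sqrt ((m : ℝ) + 1)) /
      (psi0 (t / Real.sqrt ((m : ℝ) + 1)) : ℂ)) -
    (m : ℂ) * (scaledDeviation x (t / Real.sqrt (m : ℝ)) /
      (psi0 (t / Real.sqrt (m : ℝ)) : ℂ))

/-- The first `n` observations of a sequence of random variables (enumerated from `0`),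
at the outcome `ω`. -/
def sample {Ω : Type*} (X : ℕ → Ω → ℝ) (n : ℕ) (ω : Ω) : Fin n → ℝ :=
  fun k => X k ω

/-- `Y_n = o_P(a_n)`: the quotients `Y_n / a_n` converge to `0` in probability. -/
def IsLittleOP {Ω : Type*} [MeasurableSpace Ω] (P : MeasureTheory.Measure Ω)
    (Y : ℕ → Ω → ℝ) (a : ℕ → ℝ) : Prop :=
  MeasureTheory.TendstoInMeasure P (fun n ω => Y n ω / a n) Filter.atTop (fun _ => (0 : ℝ))

/-- `Y_n = O_P(a_n)`: the quotients `Y_n / a_n` are bounded in probability. -/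
def IsBigOP {Ω : Type*} [MeasurableSpace Ω] (P : MeasureTheory.Measure Ω)
    (Y : ℕ → Ω → ℝ) (a : ℕ → ℝ) : Prop :=
  ∀ ε : ℝ, 0 < ε → ∃ C : ℝ, ∃ N : ℕ, ∀ n : ℕ, N ≤ n →
    P {ω | C < |Y n ω / a n|} ≤ ENNReal.ofReal ε

end SSTN

end

/-! The function `psi0` is a fixed point of the self-similarity operator: `psi0 (t / √m) ^ m = psi0
t`. Hence `psi0 t` may be subtracted from both powers in D_m, leaving two differences a^k - c^k
between numbers of the closed unit disc (`iterDiscrepancy_eq`). There powers are Lipschitz and have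
a quadratic linearization error, with constants depending only on k. With V(t) = |U_n(t/√(m+1))| +
|U_n(t/√m)| this gives, surely and for every n, √n |D_m| ≤ (m+1) V and √n |√n D_m - ψ₀ H_m| ≤ (m+1)²
V². Factoring a difference of squares, √n |n |D_m|² - ψ₀² |H_m|²| ≤ 2 (m+1)³ V³
(`sqrt_mul_abs_sub_le`).

Everything then follows from one probabilistic fact: each absolute moment of U_n(t) of order at
least 1 is bounded uniformly in n and |t| ≤ T (`momentBounded_scaledDeviation`). By location-scale
invariance the data may be taken standard normal. Replacing the standardized observations by the raw
ones costs at most |t| (|S - 1| + |X̄|), so |U_n(t)| is dominated by a polynomial in the absolute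
normalized sums of cos(tz) - ψ₀(t), sin(tz), z² - 1 and z (`norm_scaledDeviation_le`). These
functions are centred and bounded by z² + c with c independent of t, so a Chernoff-type bound
controls exponential moments of their normalized sums (`lintegral_exp_abs_normalized_sum_le`). No
limit theorem is used.

Jensen and Tonelli carry the moment bounds through the integral over t, and Markov-type inequalities
turn them into the stated conclusions. -/

namespace SSTN

open MeasureTheory ProbabilityTheory Filter
open scoped ENNReal NNReal

/-! ### Families with uniformly bounded moments. -/

section MomentBounds

variable {Ω : Type*} [MeasurableSpace Ω] {P : Measure Ω} {ι : Type*}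

/-- A family of random variables all of whose absolute moments are bounded uniformly. -/
def MomentBounded (P : Measure Ω) (Y : ι → Ω → ℝ) : Prop :=
  (∀ i, AEMeasurable (Y i) P) ∧
    ∀ p : ℝ, 1 ≤ p → ∃ C : ℝ≥0∞, C ≠ ∞ ∧ ∀ i, ∫⁻ ω, ‖Y i ω‖ₑ ^ p ∂P ≤ C

lemma MomentBounded.mono {Y Z : ι → Ω → ℝ} (hZ : MomentBounded P Z)
    (hY : ∀ i, AEMeasurable (Y i) P) (hYZ : ∀ i ω, |Y i ω| ≤ |Z i ω|) :
    MomentBounded P Y := by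
  refine ⟨hY, fun p hp => ?_⟩
  obtain ⟨C, hC, h⟩ := hZ.2 p hp
  refine ⟨C, hC, fun i => (lintegral_mono fun ω => ?_).trans (h i)⟩
  have : ‖Y i ω‖ₑ ≤ ‖Z i ω‖ₑ := enorm_le_iff_norm_le.2 (by simpa using hYZ i ω)
  gcongr

lemma MomentBounded.comp_index {κ : Type*} {Y : ι → Ω → ℝ} (hY : MomentBounded P Y) (f : κ → ι) :
    MomentBounded P (fun k => Y (f k)) := by
  refine ⟨fun k => hY.1 _, fun p hp => ?_⟩
  obtain ⟨C, hC, h⟩ := hY.2 p hp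
  exact ⟨C, hC, fun k => h _⟩

lemma MomentBounded.add {Y Z : ι → Ω → ℝ} (hY : MomentBounded P Y) (hZ : MomentBounded P Z) :
    MomentBounded P (fun i ω => Y i ω + Z i ω) := by
  refine ⟨fun i => (hY.1 i).add (hZ.1 i), fun p hp => ?_⟩
  obtain ⟨C, hC, h⟩ := hY.2 p hp
  obtain ⟨C', hC', h'⟩ := hZ.2 p hp
  refine ⟨2 ^ (p - 1) * (C + C'), ?_, fun i => ?_⟩
  · exact ENNReal.mul_ne_top (by simp) (by simp [hC, hC'])
  calc ∫⁻ ω, ‖Y i ω + Z i ω‖ₑ ^ p ∂P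
      ≤ ∫⁻ ω, 2 ^ (p - 1) * (‖Y i ω‖ₑ ^ p + ‖Z i ω‖ₑ ^ p) ∂P := by
        refine lintegral_mono fun ω => ?_
        refine le_trans ?_ (ENNReal.rpow_add_le_mul_rpow_add_rpow _ _ hp)
        exact ENNReal.rpow_le_rpow (enorm_add_le _ _) (by linarith)
    _ = 2 ^ (p - 1) * (∫⁻ ω, ‖Y i ω‖ₑ ^ p ∂P + ∫⁻ ω, ‖Z i ω‖ₑ ^ p ∂P) := by
        rw [lintegral_const_mul' _ _ (by simp),
          lintegral_add_left' ((hY.1 i).enorm.pow_const p)]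
    _ ≤ _ := by gcongr; exacts [h i, h' i]

lemma MomentBounded.const_mul {Y : ι → Ω → ℝ} (hY : MomentBounded P Y) (c : ℝ) :
    MomentBounded P (fun i ω => c * Y i ω) := by
  refine ⟨fun i => (hY.1 i).const_mul c, fun p hp => ?_⟩
  obtain ⟨C, hC, h⟩ := hY.2 p hp
  have hc : ‖c‖ₑ ^ p ≠ ∞ := by
    simp [ENNReal.rpow_eq_top_iff, show ¬ p < 0 by linarith]
  refine ⟨‖c‖ₑ ^ p * C, ENNReal.mul_ne_top hc hC, fun i => ?_⟩
  simp_rw [enorm_mul, ENNReal.mul_rpow_of_nonneg _ _ (zero_le_one.trans hp)]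
  rw [lintegral_const_mul' _ _ hc]
  gcongr
  exact h i

lemma MomentBounded.pow {Y : ι → Ω → ℝ} (hY : MomentBounded P Y) {k : ℕ} (hk : 1 ≤ k) :
    MomentBounded P (fun i ω => Y i ω ^ k) := by
  refine ⟨fun i => (hY.1 i).pow_const k, fun p hp => ?_⟩
  have hk' : (1 : ℝ) ≤ k := by exact_mod_cast hk
  obtain ⟨C, hC, h⟩ := hY.2 (k * p) (by nlinarith)
  refine ⟨C, hC, fun i => le_trans (le_of_eq ?_) (h i)⟩
  simp_rw [enorm_pow, ← ENNReal.rpow_natCast, ENNReal.rpow_mul]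

lemma MomentBounded.abs {Y : ι → Ω → ℝ} (hY : MomentBounded P Y) :
    MomentBounded P (fun i ω => |Y i ω|) :=
  hY.mono (fun i => (hY.1 i).abs) fun i ω => by simp

/-- Raise u ≤ exp u at u = b x / p to the power p. -/
lemma rpow_le_mul_exp {p b x : ℝ} (hp : 0 < p) (hb : 0 < b) (hx : 0 ≤ x) :
    x ^ p ≤ (p / b) ^ p * Real.exp (b * x) := by
  have h1 : b * x / p ≤ Real.exp (b * x / p) := by
    linarith [Real.add_one_le_exp (b * x / p)]
  have h2 : (b * x / p) ^ p ≤ Real.exp (b * x) := by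
    calc (b * x / p) ^ p ≤ Real.exp (b * x / p) ^ p := by gcongr
      _ = Real.exp (b * x) := by rw [← Real.exp_mul]; congr 1; field_simp
  calc x ^ p = (p / b * (b * x / p)) ^ p := by congr 1; field_simp
    _ = (p / b) ^ p * (b * x / p) ^ p := Real.mul_rpow (by positivity) (by positivity)
    _ ≤ _ := by gcongr

lemma momentBounded_of_lintegral_exp_le {Y : ι → Ω → ℝ} (hY : ∀ i, AEMeasurable (Y i) P)
    {b : ℝ} (hb : 0 < b) {K : ℝ≥0∞} (hK : K ≠ ∞)
    (h : ∀ i, ∫⁻ ω, ENNReal.ofReal (Real.exp (b * |Y i ω|)) ∂P ≤ K) :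
    MomentBounded P Y := by
  refine ⟨hY, fun p hp => ⟨ENNReal.ofReal ((p / b) ^ p) * K,
    ENNReal.mul_ne_top ENNReal.ofReal_ne_top hK, fun i => ?_⟩⟩
  have hp0 : 0 < p := by linarith
  calc ∫⁻ ω, ‖Y i ω‖ₑ ^ p ∂P
      ≤ ∫⁻ ω, ENNReal.ofReal ((p / b) ^ p) * ENNReal.ofReal (Real.exp (b * |Y i ω|)) ∂P := by
        refine lintegral_mono fun ω => ?_
        rw [← ENNReal.ofReal_mul (by positivity), Real.enorm_eq_ofReal_abs,
          ENNReal.ofReal_rpow_of_nonneg (abs_nonneg _) hp0.le]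
        exact ENNReal.ofReal_le_ofReal (rpow_le_mul_exp hp0 hb (abs_nonneg _))
    _ ≤ _ := by
        rw [lintegral_const_mul' _ _ ENNReal.ofReal_ne_top]
        gcongr
        exact h i

end MomentBounds

/-! ### Exponential moments of normalized sums. -/

section NormalizedSums

/-- The Taylor remainder is at most (l x)² exp |l x|. One half of exp(a|x|) absorbs exp |l x|, the
other absorbs x²; the 8 comes from u²/2 ≤ exp u at u = a|x|/2. -/
lemma exp_mul_le_one_add {a l x : ℝ} (ha : 0 < a) (hl : |l| ≤ a / 2) :
    Real.exp (l * x) ≤ 1 + l * x + 8 * l ^ 2 / a ^ 2 * Real.exp (a * |x|) := by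
  have h1 : Real.exp (l * x) ≤ 1 + l * x + (l * x) ^ 2 * Real.exp |l * x| := by
    have := Complex.norm_exp_sub_sum_le_norm_mul_exp ((l * x : ℝ) : ℂ) 2
    simp only [Finset.sum_range_succ, Finset.range_zero, Finset.sum_empty, pow_zero,
      Nat.factorial, Complex.norm_real, Real.norm_eq_abs, sq_abs, ← Complex.ofReal_exp] at this
    have h2 : (Real.exp (l * x) : ℂ) - (0 + 1 / ((1 : ℕ) : ℂ) + ((l * x : ℝ) : ℂ) ^ 1 /
        ((((0 + 1) * 1 : ℕ)) : ℂ)) = ((Real.exp (l * x) - (1 + l * x) : ℝ) : ℂ) := by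
      push_cast; ring
    rw [h2, Complex.norm_real, Real.norm_eq_abs] at this
    linarith [le_abs_self (Real.exp (l * x) - (1 + l * x))]
  have h2 : Real.exp |l * x| ≤ Real.exp (a * |x| / 2) := by
    rw [Real.exp_le_exp, abs_mul]
    nlinarith [abs_nonneg x]
  have h3 : x ^ 2 ≤ 8 / a ^ 2 * Real.exp (a * |x| / 2) := by
    have := Real.quadratic_le_exp_of_nonneg (x := a * |x| / 2) (by positivity)
    rw [div_mul_eq_mul_div, le_div_iff₀ (by positivity)]
    have h4 : (a * |x| / 2) ^ 2 = x ^ 2 * a ^ 2 / 4 := by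
      rw [div_pow, mul_pow, sq_abs]; ring
    have h5 : 0 ≤ a * |x| / 2 := by positivity
    nlinarith
  have h6 : Real.exp (a * |x|) = Real.exp (a * |x| / 2) * Real.exp (a * |x| / 2) := by
    rw [← Real.exp_add]; congr 1; ring
  calc Real.exp (l * x) ≤ 1 + l * x + (l * x) ^ 2 * Real.exp |l * x| := h1
    _ ≤ 1 + l * x + l ^ 2 * (8 / a ^ 2 * Real.exp (a * |x| / 2)) * Real.exp (a * |x| / 2) := by
        rw [mul_pow]; gcongr
    _ = _ := by rw [h6]; ring

variable {Ω : Type*} [MeasurableSpace Ω] {P : Measure Ω}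

lemma integrable_of_integrable_exp_abs {ξ : Ω → ℝ} (hξ : AEMeasurable ξ P) {a : ℝ} (ha : 0 < a)
    (hint : Integrable (fun ω => Real.exp (a * |ξ ω|)) P) : Integrable ξ P := by
  refine (hint.const_mul a⁻¹).mono' hξ.aestronglyMeasurable (ae_of_all _ fun ω => ?_)
  rw [Real.norm_eq_abs, inv_mul_eq_div, le_div_iff₀ ha]
  linarith [Real.add_one_le_exp (a * |ξ ω|)]

lemma integrable_exp_mul_of_abs {ξ : Ω → ℝ} (hξ : AEMeasurable ξ P) {a l : ℝ} (hl : |l| ≤ a)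
    (hint : Integrable (fun ω => Real.exp (a * |ξ ω|)) P) :
    Integrable (fun ω => Real.exp (l * ξ ω)) P := by
  refine hint.mono' (hξ.const_mul l).exp.aestronglyMeasurable (ae_of_all _ fun ω => ?_)
  rw [Real.norm_eq_abs, Real.abs_exp, Real.exp_le_exp]
  calc l * ξ ω ≤ |l| * |ξ ω| := by rw [← abs_mul]; exact le_abs_self _
    _ ≤ _ := by gcongr

/-- Centring removes the linear term, which leaves a sub-Gaussian bound for small l. -/
lemma mgf_le_exp_sq [IsProbabilityMeasure P] {ξ : Ω → ℝ} (hξ : AEMeasurable ξ P) {a l K : ℝ}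
    (ha : 0 < a) (hl : |l| ≤ a / 2) (hint : Integrable (fun ω => Real.exp (a * |ξ ω|)) P)
    (hK : ∫ ω, Real.exp (a * |ξ ω|) ∂P ≤ K) (h0 : ∫ ω, ξ ω ∂P = 0) :
    mgf ξ P l ≤ Real.exp (8 * l ^ 2 / a ^ 2 * K) := by
  have hi := integrable_of_integrable_exp_abs hξ ha hint
  have hi1 : Integrable (fun ω => 1 + l * ξ ω) P := (integrable_const _).add (hi.const_mul l)
  calc mgf ξ P l ≤ ∫ ω, (1 + l * ξ ω + 8 * l ^ 2 / a ^ 2 * Real.exp (a * |ξ ω|)) ∂P :=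
        integral_mono (integrable_exp_mul_of_abs hξ (by linarith) hint)
          (hi1.add (hint.const_mul _)) fun ω => exp_mul_le_one_add ha hl
    _ = 1 + 8 * l ^ 2 / a ^ 2 * ∫ ω, Real.exp (a * |ξ ω|) ∂P := by
        rw [integral_add hi1 (hint.const_mul _), integral_add (integrable_const _)
          (hi.const_mul l), integral_const_mul, integral_const_mul, h0]
        simp
    _ ≤ 1 + 8 * l ^ 2 / a ^ 2 * K := by gcongr
    _ ≤ _ := by linarith [Real.add_one_le_exp (8 * l ^ 2 / a ^ 2 * K)]

/-- The exponential moments of the normalized partial sums of independent centred variables are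
bounded by a constant that depends only on a bound for the exponential moments of the summands. -/
lemma lintegral_exp_abs_normalized_sum_le [IsProbabilityMeasure P] {ξ : ℕ → Ω → ℝ}
    (hindep : iIndepFun ξ P) (hξ : ∀ k, AEMeasurable (ξ k) P) {a K : ℝ} (ha : 0 < a)
    (hint : ∀ k, Integrable (fun ω => Real.exp (a * |ξ k ω|)) P)
    (hK : ∀ k, ∫ ω, Real.exp (a * |ξ k ω|) ∂P ≤ K) (h0 : ∀ k, ∫ ω, ξ k ω ∂P = 0) (n : ℕ) :
    ∫⁻ ω, ENNReal.ofReal (Real.exp (a / 2 * |(√(n : ℝ))⁻¹ * ∑ k ∈ Finset.range n, ξ k ω|)) ∂P ≤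
      ENNReal.ofReal (2 * Real.exp (2 * K)) := by
  have hK0 : 0 ≤ K := (integral_nonneg fun ω => (Real.exp_pos _).le).trans (hK 0)
  -- For |l| ≤ a/(2√n) the n factors exp(8 l² K / a²) multiply to at most exp(2K). At n = 0 the
  -- inverse is 0, which forces l = 0.
  have key : ∀ l : ℝ, |l| ≤ a / 2 * (√(n : ℝ))⁻¹ →
      ∫⁻ ω, ENNReal.ofReal (Real.exp (l * ∑ k ∈ Finset.range n, ξ k ω)) ∂P ≤
        ENNReal.ofReal (Real.exp (2 * K)) := by
    intro l hl
    have hinv : (√(n : ℝ))⁻¹ ≤ 1 := by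
      rcases Nat.eq_zero_or_pos n with rfl | hn
      · simp
      · exact inv_le_one_of_one_le₀ (Real.one_le_sqrt.2 (by exact_mod_cast hn))
    have hl2 : |l| ≤ a / 2 := hl.trans (by nlinarith)
    have hint' : ∀ k, Integrable (fun ω => Real.exp (l * ξ k ω)) P := fun k =>
      integrable_exp_mul_of_abs (hξ k) (by linarith) (hint k)
    have hm := hindep.mgf_sum₀ (t := l) hξ (Finset.range n)
    -- Without integrability the mgf of the sum would be 0 by convention, yet it is a product of
    -- positive factors.
    by_cases hI : Integrable (fun ω => Real.exp (l * ∑ k ∈ Finset.range n, ξ k ω)) P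
    swap
    · exfalso
      have hpos : 0 < mgf (∑ k ∈ Finset.range n, ξ k) P l := by
        rw [hm]; exact Finset.prod_pos fun k _ => mgf_pos (hint' k)
      rw [mgf, integral_undef] at hpos
      · exact lt_irrefl _ hpos
      · simpa [Finset.sum_apply] using hI
    rw [← ofReal_integral_eq_lintegral_ofReal hI (ae_of_all _ fun ω => (Real.exp_pos _).le)]
    refine ENNReal.ofReal_le_ofReal ?_
    have e : ∫ ω, Real.exp (l * ∑ k ∈ Finset.range n, ξ k ω) ∂P =
        mgf (∑ k ∈ Finset.range n, ξ k) P l := by simp [mgf, Finset.sum_apply]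
    rw [e, hm]
    calc ∏ k ∈ Finset.range n, mgf (ξ k) P l
        ≤ ∏ k ∈ Finset.range n, Real.exp (8 * l ^ 2 / a ^ 2 * K) :=
          Finset.prod_le_prod (fun k _ => mgf_nonneg) fun k _ =>
            mgf_le_exp_sq (hξ k) ha hl2 (hint k) (hK k) (h0 k)
      _ = Real.exp (n * (8 * l ^ 2 / a ^ 2 * K)) := by
          rw [Finset.prod_const, Finset.card_range, ← Real.exp_nat_mul]
      _ ≤ Real.exp (2 * K) := by
          rw [Real.exp_le_exp, ← mul_assoc]
          refine mul_le_mul_of_nonneg_right ?_ hK0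
          have h1 : l ^ 2 ≤ (a / 2 * (√(n : ℝ))⁻¹) ^ 2 := sq_le_sq' (by linarith [neg_abs_le l])
            ((le_abs_self l).trans hl)
          rw [mul_pow, inv_pow, Real.sq_sqrt (Nat.cast_nonneg n)] at h1
          have h2 : (n : ℝ) * (n : ℝ)⁻¹ ≤ 1 := mul_inv_le_one
          calc (n : ℝ) * (8 * l ^ 2 / a ^ 2) ≤ n * (8 * ((a / 2) ^ 2 * (n : ℝ)⁻¹) / a ^ 2) := by
                gcongr
            _ = 2 * ((n : ℝ) * (n : ℝ)⁻¹) := by field_simp; ring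
            _ ≤ 2 := by linarith
  have hb : |a / 2 * (√(n : ℝ))⁻¹| = a / 2 * (√(n : ℝ))⁻¹ := abs_of_nonneg (by positivity)
  have hmeas : AEMeasurable (fun ω => ENNReal.ofReal
      (Real.exp (a / 2 * (√(n : ℝ))⁻¹ * ∑ k ∈ Finset.range n, ξ k ω))) P := by fun_prop
  calc ∫⁻ ω, ENNReal.ofReal
        (Real.exp (a / 2 * |(√(n : ℝ))⁻¹ * ∑ k ∈ Finset.range n, ξ k ω|)) ∂P
      ≤ ∫⁻ ω, (ENNReal.ofReal
          (Real.exp (a / 2 * (√(n : ℝ))⁻¹ * ∑ k ∈ Finset.range n, ξ k ω)) +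
        ENNReal.ofReal
          (Real.exp (-(a / 2 * (√(n : ℝ))⁻¹) * ∑ k ∈ Finset.range n, ξ k ω))) ∂P := by
        refine lintegral_mono fun ω => ?_
        rw [← ENNReal.ofReal_add (Real.exp_pos _).le (Real.exp_pos _).le]
        refine ENNReal.ofReal_le_ofReal ?_
        generalize ∑ k ∈ Finset.range n, ξ k ω = s
        rcases abs_choice ((√(n : ℝ))⁻¹ * s) with h | h <;> rw [h]
        · rw [← mul_assoc]; linarith [Real.exp_pos (-(a / 2 * (√(n : ℝ))⁻¹) * s)]
        · rw [show a / 2 * -((√(n : ℝ))⁻¹ * s) = -(a / 2 * (√(n : ℝ))⁻¹) * s by ring]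
          linarith [Real.exp_pos (a / 2 * (√(n : ℝ))⁻¹ * s)]
    _ ≤ ENNReal.ofReal (Real.exp (2 * K)) + ENNReal.ofReal (Real.exp (2 * K)) := by
        rw [lintegral_add_left' hmeas]
        exact add_le_add (key _ hb.le) (key _ (by rw [abs_neg, hb]))
    _ = _ := by
        rw [← ENNReal.ofReal_add (Real.exp_pos _).le (Real.exp_pos _).le, ← two_mul]

end NormalizedSums

/-! ### Gaussian expectations of the summands. -/

section Gaussian

/-- Since 1/4 < 1/2, the Gaussian density still leaves a factor exp(-z²/4). -/
lemma integrable_exp_sq_gaussianReal (c : ℝ) :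
    Integrable (fun z : ℝ => Real.exp (1 / 4 * (z ^ 2 + c))) (gaussianReal 0 1) := by
  rw [gaussianReal_of_var_ne_zero _ one_ne_zero,
    integrable_withDensity_iff (measurable_gaussianPDF 0 1)
      (ae_of_all _ fun _ => gaussianPDF_lt_top)]
  have h := (integrable_exp_neg_mul_sq (b := 1 / 4) (by norm_num)).const_mul
    (Real.exp (c / 4) * (√(2 * Real.pi * ((1 : ℝ≥0) : ℝ)))⁻¹)
  refine h.congr (ae_of_all _ fun z => ?_)
  simp only [toReal_gaussianPDF, gaussianPDFReal]
  rw [mul_right_comm, mul_comm _ ((√(2 * Real.pi * ((1 : ℝ≥0) : ℝ)))⁻¹ * _),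
    mul_assoc _ _ (Real.exp (1 / 4 * (z ^ 2 + c))), ← Real.exp_add, ← Real.exp_add, mul_comm]
  congr 2
  simp
  ring

lemma integral_id_stdGaussian : ∫ z, z ∂gaussianReal 0 1 = 0 := integral_id_gaussianReal

lemma integral_sq_sub_one_stdGaussian : ∫ z, (z ^ 2 - 1) ∂gaussianReal 0 1 = 0 := by
  have h : Var[id; gaussianReal 0 1] = ((1 : ℝ≥0) : ℝ) := variance_id_gaussianReal
  rw [variance_of_integral_eq_zero aemeasurable_id (by simp)] at h
  have hi : Integrable (fun z : ℝ => z ^ 2) (gaussianReal 0 1) :=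
    (memLp_id_gaussianReal 2).integrable_sq
  rw [integral_sub hi (integrable_const _)]
  simpa [sub_eq_zero] using h

lemma integral_cexp_stdGaussian (t : ℝ) :
    ∫ z : ℝ, Complex.exp (t * z * Complex.I) ∂gaussianReal 0 1 = (psi0 t : ℂ) := by
  rw [← charFun_apply_real, charFun_gaussianReal]
  simp [psi0, neg_div]

lemma integrable_cexp_stdGaussian (t : ℝ) :
    Integrable (fun z : ℝ => Complex.exp (t * z * Complex.I)) (gaussianReal 0 1) := by
  refine (integrable_const (1 : ℝ)).mono' (by fun_prop) (ae_of_all _ fun z => ?_)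
  rw [← Complex.ofReal_mul, Complex.norm_exp_ofReal_mul_I]

lemma integral_cos_sub_stdGaussian (t : ℝ) :
    ∫ z, (Real.cos (t * z) - psi0 t) ∂gaussianReal 0 1 = 0 := by
  have h := congrArg Complex.re (integral_cexp_stdGaussian t)
  have h2 := integral_re (𝕜 := ℂ) (integrable_cexp_stdGaussian t)
  have h3 : ∀ z : ℝ, RCLike.re (Complex.exp (t * z * Complex.I)) = Real.cos (t * z) := fun z => by
    rw [← Complex.ofReal_mul]; exact Complex.exp_ofReal_mul_I_re _
  have hi := (integrable_cexp_stdGaussian t).re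
  simp only [h3] at h2 hi
  rw [integral_sub hi (integrable_const _), h2]
  simpa [sub_eq_zero] using h

lemma integral_sin_stdGaussian (t : ℝ) : ∫ z, Real.sin (t * z) ∂gaussianReal 0 1 = 0 := by
  have h := congrArg Complex.im (integral_cexp_stdGaussian t)
  have h2 := integral_im (𝕜 := ℂ) (integrable_cexp_stdGaussian t)
  have h3 : ∀ z : ℝ, RCLike.im (Complex.exp (t * z * Complex.I)) = Real.sin (t * z) := fun z => by
    rw [← Complex.ofReal_mul]; exact Complex.exp_ofReal_mul_I_im _
  simp only [h3] at h2
  rw [h2]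
  simpa using h

/-- The normalized partial sum `n^{-1/2} ∑ g(Z_k)`. -/
noncomputable def normalizedSum {Ω : Type*} (Z : ℕ → Ω → ℝ) (g : ℝ → ℝ) (n : ℕ) (ω : Ω) : ℝ :=
  (√(n : ℝ))⁻¹ * ∑ k ∈ Finset.range n, g (Z k ω)

/-- The common majorant z² + c makes the bound uniform in the index, which later is the argument t.
-/
lemma momentBounded_normalizedSum {Ω ι : Type*} [MeasurableSpace Ω] {P : Measure Ω}
    [IsProbabilityMeasure P] {Z : ℕ → Ω → ℝ} (hindep : iIndepFun Z P)
    (hlaw : ∀ k, HasLaw (Z k) (gaussianReal 0 1) P) {g : ι → ℝ → ℝ} (hg : ∀ i, Measurable (g i))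
    {c : ℝ} (hgc : ∀ i z, |g i z| ≤ z ^ 2 + c) (h0 : ∀ i, ∫ z, g i z ∂gaussianReal 0 1 = 0) :
    MomentBounded P (fun (j : ℕ × ι) => normalizedSum Z (g j.2) j.1) := by
  have hm : ∀ i k, AEMeasurable (fun ω => g i (Z k ω)) P := fun i k =>
    (hg i).comp_aemeasurable (hlaw k).aemeasurable
  have hexp : ∀ i, Integrable (fun z => Real.exp (1 / 4 * |g i z|)) (gaussianReal 0 1) := fun i =>
    (integrable_exp_sq_gaussianReal c).mono' (by have := hg i; fun_prop) (ae_of_all _ fun z => by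
      rw [Real.norm_eq_abs, Real.abs_exp, Real.exp_le_exp]
      linarith [hgc i z])
  refine momentBounded_of_lintegral_exp_le (b := 1 / 4 / 2)
    (K := ENNReal.ofReal (2 * Real.exp (2 * ∫ z, Real.exp (1 / 4 * (z ^ 2 + c)) ∂gaussianReal 0 1)))
    (fun j => ?_) (by norm_num) ENNReal.ofReal_ne_top fun j => ?_
  · have := hm j.2
    unfold normalizedSum
    fun_prop
  · refine lintegral_exp_abs_normalized_sum_le (ξ := fun k ω => g j.2 (Z k ω))
      (hindep.comp (fun _ => g j.2) fun _ => hg j.2) (hm j.2) (by norm_num) (fun k => ?_)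
      (fun k => ?_) (fun k => ?_) j.1
    · have := hexp j.2
      rw [← (hlaw k).map_eq] at this
      exact this.comp_aemeasurable (hlaw k).aemeasurable
    · have e := (hlaw k).integral_comp (f := fun z => Real.exp (1 / 4 * |g j.2 z|))
        (hexp j.2).aestronglyMeasurable
      simp only [Function.comp_def] at e
      rw [e]
      refine integral_mono (hexp j.2) (integrable_exp_sq_gaussianReal c) fun z => ?_
      simp only [Real.exp_le_exp]
      linarith [hgc j.2 z]
    · have e := (hlaw k).integral_comp (f := g j.2) (hg j.2).aestronglyMeasurable
      simp only [Function.comp_def] at e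
      rw [e, h0]

end Gaussian

/-! ### Powers in the closed unit disc. -/

section PowerEstimates

variable {a c : ℂ}

lemma norm_pow_sub_pow_le_mul (ha : ‖a‖ ≤ 1) (hc : ‖c‖ ≤ 1) (m : ℕ) :
    ‖a ^ m - c ^ m‖ ≤ m * ‖a - c‖ := by
  induction m with
  | zero => simp
  | succ m ih =>
    have e : a ^ (m + 1) - c ^ (m + 1) = a * (a ^ m - c ^ m) + (a - c) * c ^ m := by ring
    have h1 : ‖a * (a ^ m - c ^ m)‖ ≤ m * ‖a - c‖ := by
      rw [norm_mul]
      nlinarith [norm_nonneg (a ^ m - c ^ m), norm_nonneg a]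
    have h2 : ‖(a - c) * c ^ m‖ ≤ ‖a - c‖ := by
      rw [norm_mul, norm_pow]
      exact mul_le_of_le_one_right (norm_nonneg _) (pow_le_one₀ (norm_nonneg _) hc)
    rw [e]
    push_cast
    linarith [norm_add_le (a * (a ^ m - c ^ m)) ((a - c) * c ^ m)]

/-- The next remainder is a times the current one plus (m+1) c^m (a-c)². The crude constant survives
the induction because (m+1)² + (m+1) ≤ (m+2)². -/
lemma norm_pow_succ_sub_linear_le (ha : ‖a‖ ≤ 1) (hc : ‖c‖ ≤ 1) (m : ℕ) :
    ‖a ^ (m + 1) - c ^ (m + 1) - (m + 1) * c ^ m * (a - c)‖ ≤ (m + 1) ^ 2 * ‖a - c‖ ^ 2 := by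
  induction m with
  | zero => simp
  | succ m ih =>
    have e : a ^ (m + 1 + 1) - c ^ (m + 1 + 1) - (((m + 1 : ℕ) : ℂ) + 1) * c ^ (m + 1) * (a - c) =
        a * (a ^ (m + 1) - c ^ (m + 1) - (m + 1) * c ^ m * (a - c)) +
          (m + 1) * c ^ m * (a - c) ^ 2 := by push_cast; ring
    have h1 : ‖a * (a ^ (m + 1) - c ^ (m + 1) - (m + 1) * c ^ m * (a - c))‖ ≤
        (m + 1) ^ 2 * ‖a - c‖ ^ 2 := by
      rw [norm_mul]
      exact (mul_le_of_le_one_left (norm_nonneg _) ha).trans ih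
    have h2 : ‖((m : ℂ) + 1) * c ^ m * (a - c) ^ 2‖ ≤ (m + 1) * ‖a - c‖ ^ 2 := by
      rw [norm_mul, norm_mul, norm_pow, norm_pow]
      have h3 : ‖(m : ℂ) + 1‖ = m + 1 := by
        rw [← Nat.cast_succ, Complex.norm_natCast]; push_cast; rfl
      rw [h3]
      gcongr
      exact mul_le_of_le_one_right (by positivity) (pow_le_one₀ (norm_nonneg _) hc)
    rw [e]
    push_cast
    nlinarith [norm_add_le (a * (a ^ (m + 1) - c ^ (m + 1) - (m + 1) * c ^ m * (a - c)))
      ((m + 1) * c ^ m * (a - c) ^ 2), sq_nonneg ‖a - c‖, (Nat.cast_nonneg m : (0 : ℝ) ≤ m)]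

end PowerEstimates

/-! ### The normal characteristic function. -/

section Psi

lemma psi0_pos (t : ℝ) : 0 < psi0 t := Real.exp_pos _

lemma psi0_le_one (t : ℝ) : psi0 t ≤ 1 :=
  Real.exp_le_one_iff.2 (by nlinarith [sq_nonneg t])

lemma norm_psi0_le_one (t : ℝ) : ‖(psi0 t : ℂ)‖ ≤ 1 := by
  rw [Complex.norm_real, Real.norm_of_nonneg (psi0_pos t).le]
  exact psi0_le_one t

/-- The standard normal characteristic function is self-similar. -/
lemma psi0_div_sqrt_pow {m : ℕ} (hm : m ≠ 0) (t : ℝ) : psi0 (t / √(m : ℝ)) ^ m = psi0 t := by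
  have : (m : ℝ) ≠ 0 := by exact_mod_cast hm
  rw [psi0, psi0, ← Real.exp_nat_mul, div_pow, Real.sq_sqrt (Nat.cast_nonneg m)]
  congr 1
  field_simp

lemma continuous_psi0 : Continuous psi0 := by unfold psi0; fun_prop

end Psi

/-! ### Deterministic linearization of the discrepancy, and measurability. -/

section Discrepancy

variable {n : ℕ} (x : Fin n → ℝ)

/-- An average of unimodular numbers, hence in the unit disc. The convention x/0 = 0 is consistent
with this form when the standard deviation vanishes. -/
lemma stdEcf_eq (t : ℝ) : stdEcf x t = (1 / (n : ℂ)) *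
    ∑ k, Complex.exp (((t * ((x k - sampleMean x) / sampleSD x) : ℝ) : ℂ) * Complex.I) := by
  rw [stdEcf, ecf, mul_left_comm, Finset.mul_sum]
  congr 1
  refine Finset.sum_congr rfl fun k _ => ?_
  rw [← Complex.exp_add]
  congr 1
  push_cast
  ring

lemma norm_stdEcf_le_one (t : ℝ) : ‖stdEcf x t‖ ≤ 1 := by
  rw [stdEcf_eq, norm_mul]
  have h : ‖∑ k, Complex.exp (((t * ((x k - sampleMean x) / sampleSD x) : ℝ) : ℂ) *
      Complex.I)‖ ≤ n := by
    refine (norm_sum_le _ _).trans (le_of_eq ?_)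
    simp_rw [Complex.norm_exp_ofReal_mul_I]
    simp
  calc _ ≤ ‖(1 / (n : ℂ))‖ * n := by gcongr
    _ ≤ 1 := by
      rw [norm_div, norm_one, Complex.norm_natCast, one_div]
      exact inv_mul_le_one

lemma norm_scaledDeviation (t : ℝ) :
    ‖scaledDeviation x t‖ = √(n : ℝ) * ‖stdEcf x t - (psi0 t : ℂ)‖ := by
  rw [scaledDeviation, norm_mul, Complex.norm_real, Real.norm_of_nonneg (Real.sqrt_nonneg _)]

/-- The sum of the two deviations that enter the discrepancy `D_m`. -/
noncomputable def deviationNorm (m : ℕ) (t : ℝ) : ℝ :=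
  ‖scaledDeviation x (t / √((m : ℝ) + 1))‖ + ‖scaledDeviation x (t / √(m : ℝ))‖

lemma deviationNorm_nonneg (m : ℕ) (t : ℝ) : 0 ≤ deviationNorm x m t := by
  unfold deviationNorm; positivity

lemma iterDiscrepancy_eq {m : ℕ} (hm : m ≠ 0) (t : ℝ) :
    iterDiscrepancy m x t =
      (stdEcf x (t / √((m : ℝ) + 1)) ^ (m + 1) - (psi0 (t / √((m : ℝ) + 1)) : ℂ) ^ (m + 1)) -
      (stdEcf x (t / √(m : ℝ)) ^ m - (psi0 (t / √(m : ℝ)) : ℂ) ^ m) := by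
  have h1 := psi0_div_sqrt_pow (Nat.succ_ne_zero m) t
  have h2 := psi0_div_sqrt_pow hm t
  rw [Nat.cast_succ] at h1
  rw [← Complex.ofReal_pow, ← Complex.ofReal_pow, h1, h2]
  simp [iterDiscrepancy, selfSimTransform, selfSimOp]

/-- Writing `psi0 t` as the matching power lets one factor cancel each denominator, so ψ₀ H becomes
exactly the linear term of the power expansions. The shift to m + 1 avoids an exponent m - 1. -/
lemma psi0_mul_transformedDeviation (m : ℕ) (t : ℝ) :
    (psi0 t : ℂ) * transformedDeviation (m + 1) x t =
      ((m : ℂ) + 1 + 1) * (psi0 (t / √(((m + 1 : ℕ) : ℝ) + 1)) : ℂ) ^ (m + 1) *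
        scaledDeviation x (t / √(((m + 1 : ℕ) : ℝ) + 1)) -
      ((m : ℂ) + 1) * (psi0 (t / √((m + 1 : ℕ) : ℝ)) : ℂ) ^ m *
        scaledDeviation x (t / √((m + 1 : ℕ) : ℝ)) := by
  have h1 := psi0_div_sqrt_pow (Nat.succ_ne_zero (m + 1)) t
  have h2 := psi0_div_sqrt_pow (Nat.succ_ne_zero m) t
  rw [Nat.cast_succ] at h1
  have h1' : (psi0 t : ℂ) = (psi0 (t / √(((m + 1 : ℕ) : ℝ) + 1)) : ℂ) ^ (m + 1 + 1) := by
    rw [← Complex.ofReal_pow, h1]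
  have h2' : (psi0 t : ℂ) = (psi0 (t / √((m + 1 : ℕ) : ℝ)) : ℂ) ^ (m + 1) := by
    rw [← Complex.ofReal_pow, h2]
  have n1 : (psi0 (t / √(((m + 1 : ℕ) : ℝ) + 1)) : ℂ) ≠ 0 := by
    exact_mod_cast (psi0_pos _).ne'
  have n2 : (psi0 (t / √((m + 1 : ℕ) : ℝ)) : ℂ) ≠ 0 := by exact_mod_cast (psi0_pos _).ne'
  rw [transformedDeviation, mul_sub]
  congr 1
  · rw [h1']
    generalize (psi0 (t / √(((m + 1 : ℕ) : ℝ) + 1)) : ℂ) = c at *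
    generalize scaledDeviation x (t / √(((m + 1 : ℕ) : ℝ) + 1)) = u
    push_cast
    field_simp
    ring
  · rw [h2']
    generalize (psi0 (t / √((m + 1 : ℕ) : ℝ)) : ℂ) = c at *
    generalize scaledDeviation x (t / √((m + 1 : ℕ) : ℝ)) = u
    push_cast
    field_simp
    ring

lemma sqrt_mul_norm_iterDiscrepancy_le {m : ℕ} (hm : m ≠ 0) (t : ℝ) :
    √(n : ℝ) * ‖iterDiscrepancy m x t‖ ≤ (m + 1) * deviationNorm x m t := by
  rw [iterDiscrepancy_eq x hm, deviationNorm, norm_scaledDeviation, norm_scaledDeviation]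
  have h1 := norm_pow_sub_pow_le_mul (norm_stdEcf_le_one x (t / √((m : ℝ) + 1)))
    (norm_psi0_le_one (t / √((m : ℝ) + 1))) (m + 1)
  have h2 := norm_pow_sub_pow_le_mul (norm_stdEcf_le_one x (t / √(m : ℝ)))
    (norm_psi0_le_one (t / √(m : ℝ))) m
  push_cast at h1
  rw [← mul_add, mul_left_comm]
  refine mul_le_mul_of_nonneg_left ((norm_sub_le _ _).trans ?_) (Real.sqrt_nonneg _)
  nlinarith [norm_nonneg (stdEcf x (t / √(m : ℝ)) - (psi0 (t / √(m : ℝ)) : ℂ))]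

lemma norm_psi0_mul_transformedDeviation_le {m : ℕ} (hm : m ≠ 0) (t : ℝ) :
    ‖(psi0 t : ℂ) * transformedDeviation m x t‖ ≤ (m + 1) * deviationNorm x m t := by
  obtain ⟨m, rfl⟩ := Nat.exists_eq_succ_of_ne_zero hm
  rw [Nat.succ_eq_add_one, psi0_mul_transformedDeviation, deviationNorm]
  refine (norm_sub_le _ _).trans ?_
  simp only [norm_mul, norm_pow]
  have p1 := pow_le_one₀ (n := m + 1) (norm_nonneg _)
    (norm_psi0_le_one (t / √(((m + 1 : ℕ) : ℝ) + 1)))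
  have p2 := pow_le_one₀ (n := m) (norm_nonneg _) (norm_psi0_le_one (t / √((m + 1 : ℕ) : ℝ)))
  have e1 : ‖(m : ℂ) + 1 + 1‖ = ((m + 1 : ℕ) : ℝ) + 1 := by
    rw [← Nat.cast_succ, ← Nat.cast_succ, Complex.norm_natCast]; push_cast; rfl
  have e2 : ‖(m : ℂ) + 1‖ ≤ ((m + 1 : ℕ) : ℝ) + 1 := by
    rw [← Nat.cast_succ, Complex.norm_natCast]; push_cast; linarith
  rw [mul_add]
  refine add_le_add ?_ ?_
  · rw [e1]
    gcongr
    exact mul_le_of_le_one_right (by positivity) p1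
  · gcongr
    exact (mul_le_of_le_one_right (norm_nonneg _) p2).trans e2

/-- The linearization error of the discrepancy is of second order. -/
lemma sqrt_mul_norm_sub_le {m : ℕ} (hm : m ≠ 0) (t : ℝ) :
    √(n : ℝ) * ‖(√(n : ℝ) : ℂ) * iterDiscrepancy m x t - psi0 t * transformedDeviation m x t‖ ≤
      (m + 1) ^ 2 * deviationNorm x m t ^ 2 := by
  rw [iterDiscrepancy_eq x hm]
  obtain ⟨m, rfl⟩ := Nat.exists_eq_succ_of_ne_zero hm
  rw [Nat.succ_eq_add_one, psi0_mul_transformedDeviation, deviationNorm, norm_scaledDeviation,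
    norm_scaledDeviation, scaledDeviation, scaledDeviation]
  have h1 := norm_pow_succ_sub_linear_le (norm_stdEcf_le_one x (t / √(((m + 1 : ℕ) : ℝ) + 1)))
    (norm_psi0_le_one (t / √(((m + 1 : ℕ) : ℝ) + 1))) (m + 1)
  have h2 := norm_pow_succ_sub_linear_le (norm_stdEcf_le_one x (t / √((m + 1 : ℕ) : ℝ)))
    (norm_psi0_le_one (t / √((m + 1 : ℕ) : ℝ))) m
  generalize stdEcf x (t / √(((m + 1 : ℕ) : ℝ) + 1)) = a at *
  generalize stdEcf x (t / √((m + 1 : ℕ) : ℝ)) = b at *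
  generalize (psi0 (t / √(((m + 1 : ℕ) : ℝ) + 1)) : ℂ) = c at *
  generalize (psi0 (t / √((m + 1 : ℕ) : ℝ)) : ℂ) = d at *
  generalize hs : √(n : ℝ) = s
  have hs0 : 0 ≤ s := hs ▸ Real.sqrt_nonneg _
  push_cast at h1 ⊢
  have e : (s : ℂ) * (a ^ (m + 1 + 1) - c ^ (m + 1 + 1) - (b ^ (m + 1) - d ^ (m + 1))) -
      (((m : ℂ) + 1 + 1) * c ^ (m + 1) * (s * (a - c)) - ((m : ℂ) + 1) * d ^ m * (s * (b - d))) =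
      s * ((a ^ (m + 1 + 1) - c ^ (m + 1 + 1) - ((m : ℂ) + 1 + 1) * c ^ (m + 1) * (a - c)) -
        (b ^ (m + 1) - d ^ (m + 1) - ((m : ℂ) + 1) * d ^ m * (b - d))) := by ring
  rw [e, norm_mul, Complex.norm_real, Real.norm_of_nonneg hs0, ← mul_add, mul_pow, ← mul_assoc,
    ← sq, mul_left_comm]
  refine mul_le_mul_of_nonneg_left ((norm_sub_le _ _).trans ((add_le_add h1 h2).trans ?_))
    (sq_nonneg s)
  have hm0 : (0 : ℝ) ≤ m := Nat.cast_nonneg m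
  have q1 : ((m : ℝ) + 1) ^ 2 * ‖b - d‖ ^ 2 ≤ ((m : ℝ) + 1 + 1) ^ 2 * ‖b - d‖ ^ 2 := by
    gcongr; linarith
  have q2 : 0 ≤ ((m : ℝ) + 1 + 1) ^ 2 * (‖a - c‖ * ‖b - d‖) := by positivity
  nlinarith

lemma natCast_mul_norm_sq_iterDiscrepancy_le {m : ℕ} (hm : m ≠ 0) (t : ℝ) :
    (n : ℝ) * ‖iterDiscrepancy m x t‖ ^ 2 ≤ (m + 1) ^ 2 * deviationNorm x m t ^ 2 := by
  have h := sqrt_mul_norm_iterDiscrepancy_le x hm t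
  have h' := pow_le_pow_left₀ (by positivity) h 2
  rwa [mul_pow, mul_pow, Real.sq_sqrt (Nat.cast_nonneg n)] at h'

/-- Factor the difference of squares: the difference of the norms is of second order in V with a
gain 1/√n, their sum of first order. -/
lemma sqrt_mul_abs_sub_le {m : ℕ} (hm : m ≠ 0) (t : ℝ) :
    √(n : ℝ) * |(n : ℝ) * ‖iterDiscrepancy m x t‖ ^ 2 -
        psi0 t ^ 2 * ‖transformedDeviation m x t‖ ^ 2| ≤
      2 * (m + 1) ^ 3 * deviationNorm x m t ^ 3 := by
  have h1 := sqrt_mul_norm_iterDiscrepancy_le x hm t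
  have h2 := norm_psi0_mul_transformedDeviation_le x hm t
  have h3 := sqrt_mul_norm_sub_le x hm t
  have hV := deviationNorm_nonneg x m t
  have e1 : (n : ℝ) * ‖iterDiscrepancy m x t‖ ^ 2 =
      ‖(√(n : ℝ) : ℂ) * iterDiscrepancy m x t‖ ^ 2 := by
    rw [norm_mul, Complex.norm_real, Real.norm_of_nonneg (Real.sqrt_nonneg _), mul_pow,
      Real.sq_sqrt (Nat.cast_nonneg n)]
  have e2 : psi0 t ^ 2 * ‖transformedDeviation m x t‖ ^ 2 =
      ‖(psi0 t : ℂ) * transformedDeviation m x t‖ ^ 2 := by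
    rw [norm_mul, Complex.norm_real, Real.norm_of_nonneg (psi0_pos t).le, mul_pow]
  have h1' : ‖(√(n : ℝ) : ℂ) * iterDiscrepancy m x t‖ ≤ (m + 1) * deviationNorm x m t := by
    rwa [norm_mul, Complex.norm_real, Real.norm_of_nonneg (Real.sqrt_nonneg _)]
  rw [e1, e2]
  generalize (√(n : ℝ) : ℂ) * iterDiscrepancy m x t = A at *
  generalize (psi0 t : ℂ) * transformedDeviation m x t = B at *
  generalize deviationNorm x m t = V at *
  have e3 : |‖A‖ ^ 2 - ‖B‖ ^ 2| ≤ ‖A - B‖ * (2 * ((m + 1) * V)) := by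
    rw [sq_sub_sq, abs_mul, mul_comm]
    gcongr
    · exact abs_norm_sub_norm_le A B
    · rw [abs_of_nonneg (by positivity)]; linarith
  calc √(n : ℝ) * |‖A‖ ^ 2 - ‖B‖ ^ 2| ≤ √(n : ℝ) * (‖A - B‖ * (2 * ((m + 1) * V))) := by gcongr
    _ = √(n : ℝ) * ‖A - B‖ * (2 * ((m + 1) * V)) := by ring
    _ ≤ (m + 1) ^ 2 * V ^ 2 * (2 * ((m + 1) * V)) := by gcongr
    _ = _ := by ring

lemma continuous_stdEcf : Continuous (stdEcf x) := by
  simp_rw [funext (stdEcf_eq x)]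
  fun_prop

lemma continuous_iterDiscrepancy (m : ℕ) : Continuous (iterDiscrepancy m x) := by
  have := continuous_stdEcf x
  unfold iterDiscrepancy selfSimTransform selfSimOp
  fun_prop

lemma continuous_transformedDeviation (m : ℕ) : Continuous (transformedDeviation m x) := by
  have := continuous_stdEcf x
  have h2 := continuous_psi0
  have h3 : ∀ t, (psi0 t : ℂ) ≠ 0 := fun t => by exact_mod_cast (psi0_pos t).ne'
  unfold transformedDeviation scaledDeviation
  refine Continuous.sub ?_ ?_
  all_goals
    refine continuous_const.mul (Continuous.div ?_ ?_ fun t => h3 _) <;> fun_prop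

lemma measurable_sampleMean (n : ℕ) : Measurable (sampleMean : (Fin n → ℝ) → ℝ) := by
  unfold sampleMean; fun_prop

lemma measurable_sampleSD (n : ℕ) : Measurable (sampleSD : (Fin n → ℝ) → ℝ) := by
  have := measurable_sampleMean n
  unfold sampleSD; fun_prop

lemma measurable_stdEcf (n : ℕ) : Measurable fun q : (Fin n → ℝ) × ℝ => stdEcf q.1 q.2 := by
  have := measurable_sampleMean n
  have := measurable_sampleSD n
  simp_rw [stdEcf_eq]
  fun_prop

lemma measurable_scaledDeviation (n : ℕ) :
    Measurable fun q : (Fin n → ℝ) × ℝ => scaledDeviation q.1 q.2 := by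
  have h1 := measurable_stdEcf n
  have h2 := continuous_psi0.measurable
  unfold scaledDeviation
  fun_prop

lemma measurable_comp_snd_div {E : Type*} [MeasurableSpace E] {n : ℕ} {F : (Fin n → ℝ) → ℝ → E}
    (hF : Measurable fun q : (Fin n → ℝ) × ℝ => F q.1 q.2) (c : ℝ) :
    Measurable fun q : (Fin n → ℝ) × ℝ => F q.1 (q.2 / c) :=
  hF.comp (measurable_fst.prodMk (measurable_snd.div_const c))

lemma measurable_iterDiscrepancy (n m : ℕ) :
    Measurable fun q : (Fin n → ℝ) × ℝ => iterDiscrepancy m q.1 q.2 := by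
  have h := measurable_comp_snd_div (measurable_stdEcf n)
  unfold iterDiscrepancy selfSimTransform selfSimOp
  exact ((h _).pow_const _).sub ((h _).pow_const _)

lemma measurable_transformedDeviation (n m : ℕ) :
    Measurable fun q : (Fin n → ℝ) × ℝ => transformedDeviation m q.1 q.2 := by
  have h := measurable_comp_snd_div (measurable_scaledDeviation n)
  have h2 : ∀ c : ℝ, Measurable fun q : (Fin n → ℝ) × ℝ => (psi0 (q.2 / c) : ℂ) := fun c => by
    have := continuous_psi0.measurable
    fun_prop
  unfold transformedDeviation
  exact (((h _).div (h2 _)).const_mul _).sub (((h _).div (h2 _)).const_mul _)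

end Discrepancy

/-! ### Effect of standardizing the sample. -/

section Standardization

variable {n : ℕ}

lemma sampleMean_affine (hn : n ≠ 0) (z : Fin n → ℝ) (μ σ : ℝ) :
    sampleMean (fun k => μ + σ * z k) = μ + σ * sampleMean z := by
  have : (n : ℝ) ≠ 0 := by exact_mod_cast hn
  simp only [sampleMean, Finset.sum_add_distrib, Finset.sum_const, Finset.card_univ,
    Fintype.card_fin, nsmul_eq_mul, ← Finset.mul_sum]
  field_simp

lemma sampleSD_affine (hn : n ≠ 0) (z : Fin n → ℝ) (μ : ℝ) {σ : ℝ} (hσ : 0 ≤ σ) :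
    sampleSD (fun k => μ + σ * z k) = σ * sampleSD z := by
  have : ∀ k, (μ + σ * z k - (μ + σ * sampleMean z)) ^ 2 = σ ^ 2 * (z k - sampleMean z) ^ 2 :=
    fun k => by ring
  simp only [sampleSD, sampleMean_affine hn, this, ← Finset.mul_sum]
  rw [mul_left_comm, Real.sqrt_mul (sq_nonneg σ), Real.sqrt_sq hσ]

/-- The standardized empirical characteristic function is location-scale invariant. -/
lemma stdEcf_affine (z : Fin n → ℝ) (μ : ℝ) {σ : ℝ} (hσ : 0 < σ) (t : ℝ) :
    stdEcf (fun k => μ + σ * z k) t = stdEcf z t := by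
  rcases eq_or_ne n 0 with rfl | hn
  · simp [stdEcf_eq]
  · rw [stdEcf_eq, stdEcf_eq, sampleMean_affine hn, sampleSD_affine hn z μ hσ.le]
    congr 1
    refine Finset.sum_congr rfl fun k _ => ?_
    rw [show μ + σ * z k - (μ + σ * sampleMean z) = σ * (z k - sampleMean z) by ring,
      mul_div_mul_left _ _ hσ.ne']

lemma sampleSD_sq (z : Fin n → ℝ) :
    sampleSD z ^ 2 = (1 / (n : ℝ)) * ∑ k, (z k - sampleMean z) ^ 2 :=
  Real.sq_sqrt (mul_nonneg (by positivity) (Finset.sum_nonneg fun k _ => sq_nonneg _))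

lemma sampleSD_nonneg (z : Fin n → ℝ) : 0 ≤ sampleSD z := Real.sqrt_nonneg _

lemma sampleSD_sq_eq (hn : n ≠ 0) (z : Fin n → ℝ) :
    sampleSD z ^ 2 = (1 / (n : ℝ)) * ∑ k, z k ^ 2 - sampleMean z ^ 2 := by
  have hn' : (n : ℝ) ≠ 0 := by exact_mod_cast hn
  have hs : ∑ k, z k = n * sampleMean z := by rw [sampleMean]; field_simp
  rw [sampleSD_sq]
  simp only [sub_sq, Finset.sum_add_distrib, Finset.sum_sub_distrib, Finset.sum_const,
    Finset.card_univ, Fintype.card_fin, nsmul_eq_mul, ← Finset.mul_sum, ← Finset.sum_mul, hs]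
  field_simp
  ring

/-- A zero standard deviation forces every centred observation to vanish, so division by zero does
no harm. -/
lemma sub_sampleMean_eq (z : Fin n → ℝ) (k : Fin n) :
    z k - sampleMean z = sampleSD z * ((z k - sampleMean z) / sampleSD z) := by
  by_cases h : sampleSD z = 0
  · have hn : 0 < (n : ℝ) := by exact_mod_cast k.pos
    have h2 := sampleSD_sq z
    rw [h, zero_pow two_ne_zero, zero_eq_mul] at h2
    have h3 : ∑ k, (z k - sampleMean z) ^ 2 = 0 := h2.resolve_left (by positivity)
    rw [Finset.sum_eq_zero_iff_of_nonneg fun k _ => sq_nonneg _] at h3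
    simpa [h] using h3 k (Finset.mem_univ k)
  · field_simp

lemma mean_sq_standardized_le (z : Fin n → ℝ) :
    (1 / (n : ℝ)) * ∑ k, ((z k - sampleMean z) / sampleSD z) ^ 2 ≤ 1 := by
  simp only [div_pow, ← Finset.sum_div]
  rw [← mul_div_assoc, ← sampleSD_sq]
  exact div_self_le_one _

/-- With y the standardized sample, z - y = (S - 1) y + z̄. Use |exp(iu) - 1| ≤ |u|, |y| ≤ (1 +
y²)/2 and mean square of y at most 1. Expanding in y rather than z means that no moment of 1/S is
ever needed. -/
lemma norm_stdEcf_sub_ecf_le (hn : n ≠ 0) (z : Fin n → ℝ) (t : ℝ) :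
    ‖stdEcf z t - ecf z t‖ ≤ |t| * (|sampleSD z - 1| + |sampleMean z|) := by
  have hn' : (0 : ℝ) < n := by exact_mod_cast Nat.pos_of_ne_zero hn
  set y : Fin n → ℝ := fun k => (z k - sampleMean z) / sampleSD z with hy
  have hz : ∀ k, z k - y k = (sampleSD z - 1) * y k + sampleMean z := fun k => by
    linarith [sub_sampleMean_eq z k]
  have hy2 := mean_sq_standardized_le z
  have hterm : ∀ k, ‖Complex.exp (((t * y k : ℝ) : ℂ) * Complex.I) -
      Complex.exp (Complex.I * (t : ℂ) * (z k : ℂ))‖ ≤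
        |t| * (|sampleSD z - 1| * ((1 + y k ^ 2) / 2) + |sampleMean z|) := fun k => by
    have e : Complex.exp (((t * y k : ℝ) : ℂ) * Complex.I) =
        Complex.exp (Complex.I * (t : ℂ) * (z k : ℂ)) *
          Complex.exp (Complex.I * ((t * (y k - z k) : ℝ) : ℂ)) := by
      rw [← Complex.exp_add]; congr 1; push_cast; ring
    have e2 : Complex.I * (t : ℂ) * (z k : ℂ) = ((t * z k : ℝ) : ℂ) * Complex.I := by
      push_cast; ring
    rw [e, ← mul_sub_one, norm_mul, e2, Complex.norm_exp_ofReal_mul_I, one_mul]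
    refine Real.norm_exp_I_mul_ofReal_sub_one_le.trans ?_
    rw [Real.norm_eq_abs, abs_mul, abs_sub_comm, hz]
    gcongr
    refine (abs_add_le _ _).trans ?_
    rw [abs_mul]
    gcongr
    nlinarith [sq_nonneg (|y k| - 1), sq_abs (y k)]
  have e3 : stdEcf z t - ecf z t = (1 / (n : ℂ)) *
      ∑ k, (Complex.exp (((t * y k : ℝ) : ℂ) * Complex.I) -
        Complex.exp (Complex.I * (t : ℂ) * (z k : ℂ))) := by
    rw [stdEcf_eq, ecf, Finset.sum_sub_distrib, mul_sub]
  have e4 : ‖(1 / (n : ℂ))‖ = 1 / (n : ℝ) := by simp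
  rw [e3, norm_mul, e4]
  calc (1 / (n : ℝ)) * ‖∑ k, (Complex.exp (((t * y k : ℝ) : ℂ) * Complex.I) -
        Complex.exp (Complex.I * (t : ℂ) * (z k : ℂ)))‖
      ≤ (1 / (n : ℝ)) * ∑ k,
          |t| * (|sampleSD z - 1| * ((1 + y k ^ 2) / 2) + |sampleMean z|) := by
        gcongr
        exact (norm_sum_le _ _).trans (Finset.sum_le_sum fun k _ => hterm k)
    _ = |t| * (|sampleSD z - 1| * ((1 + (1 / (n : ℝ)) * ∑ k, y k ^ 2) / 2) + |sampleMean z|) := by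
        simp only [← Finset.mul_sum, Finset.sum_add_distrib, Finset.sum_const, Finset.card_univ,
          Fintype.card_fin, nsmul_eq_mul, ← Finset.sum_div]
        field_simp
    _ ≤ _ := by
        gcongr
        refine mul_le_of_le_one_right (abs_nonneg _) ?_
        linarith

/-- As S + 1 ≥ 1, |S - 1| ≤ |S² - 1|, and S² is polynomial in the empirical moments. -/
lemma abs_sampleSD_sub_one_le (hn : n ≠ 0) (z : Fin n → ℝ) :
    |sampleSD z - 1| ≤ |(1 / (n : ℝ)) * ∑ k, (z k ^ 2 - 1)| + sampleMean z ^ 2 := by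
  have hn' : (n : ℝ) ≠ 0 := by exact_mod_cast hn
  have h1 : |sampleSD z - 1| ≤ |sampleSD z ^ 2 - 1| := by
    rw [show sampleSD z ^ 2 - 1 = (sampleSD z - 1) * (sampleSD z + 1) by ring, abs_mul]
    refine le_mul_of_one_le_right (abs_nonneg _) ?_
    rw [abs_of_nonneg] <;> linarith [sampleSD_nonneg z]
  have h2 : sampleSD z ^ 2 - 1 = (1 / (n : ℝ)) * ∑ k, (z k ^ 2 - 1) - sampleMean z ^ 2 := by
    rw [sampleSD_sq_eq hn, Finset.sum_sub_distrib]
    simp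
    field_simp
    ring
  rw [h2] at h1
  refine h1.trans ((abs_sub _ _).trans ?_)
  rw [abs_of_nonneg (sq_nonneg (sampleMean z))]

lemma norm_ecf_sub_psi0_le (hn : n ≠ 0) (z : Fin n → ℝ) (t : ℝ) :
    ‖ecf z t - (psi0 t : ℂ)‖ ≤ |(1 / (n : ℝ)) * ∑ k, (Real.cos (t * z k) - psi0 t)| +
      |(1 / (n : ℝ)) * ∑ k, Real.sin (t * z k)| := by
  have hn' : (n : ℂ) ≠ 0 := by exact_mod_cast hn
  have e : ecf z t - (psi0 t : ℂ) =
      (((1 / (n : ℝ)) * ∑ k, (Real.cos (t * z k) - psi0 t) : ℝ) : ℂ) +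
        (((1 / (n : ℝ)) * ∑ k, Real.sin (t * z k) : ℝ) : ℂ) * Complex.I := by
    have : ∀ k, Complex.exp (Complex.I * (t : ℂ) * (z k : ℂ)) =
        Complex.cos (t * z k) + Complex.sin (t * z k) * Complex.I := fun k => by
      rw [← Complex.exp_mul_I]; congr 1; ring
    simp only [ecf, this, Finset.sum_add_distrib, ← Finset.sum_mul, Finset.sum_sub_distrib,
      Finset.sum_const, Finset.card_univ, Fintype.card_fin, nsmul_eq_mul]
    push_cast
    field_simp
    ring
  rw [e]
  refine (norm_add_le _ _).trans (le_of_eq ?_)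
  rw [norm_mul, Complex.norm_I, mul_one, Complex.norm_real, Complex.norm_real, Real.norm_eq_abs,
    Real.norm_eq_abs]

end Standardization

/-! ### What uniform moment bounds imply. -/

section Consequences

variable {Ω ι : Type*} [MeasurableSpace Ω] {P : Measure Ω}

lemma enorm_abs_rpow (y : ℝ) {p : ℝ} (hp : 0 ≤ p) : ‖|y| ^ p‖ₑ = ‖y‖ₑ ^ p := by
  rw [Real.enorm_eq_ofReal (by positivity), Real.enorm_eq_ofReal_abs,
    ENNReal.ofReal_rpow_of_nonneg (abs_nonneg _) hp]

lemma MomentBounded.iSup_lintegral_lt_top {Y : ι → Ω → ℝ} (hY : MomentBounded P Y) {p : ℝ}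
    (hp : 1 ≤ p) : (⨆ i, ∫⁻ ω, ENNReal.ofReal (|Y i ω| ^ p) ∂P) < ∞ := by
  obtain ⟨C, hC, h⟩ := hY.2 p hp
  refine (iSup_le fun i => ?_).trans_lt hC.lt_top
  refine (le_of_eq ?_).trans (h i)
  refine lintegral_congr fun ω => ?_
  rw [← enorm_abs_rpow _ (by linarith), Real.enorm_eq_ofReal (by positivity)]

lemma MomentBounded.uniformIntegrable [IsFiniteMeasure P] {Y : ι → Ω → ℝ}
    (hY : MomentBounded P Y) {p : ℝ} (hp : 1 ≤ p) :
    UniformIntegrable (fun i ω => |Y i ω| ^ p) 1 P := by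
  have hp0 : 0 ≤ p := by linarith
  obtain ⟨C, hC, h⟩ := hY.2 (2 * p) (by linarith)
  refine uniformIntegrable_of le_rfl ENNReal.one_ne_top
    (fun i => ((hY.1 i).abs.pow_const p).aestronglyMeasurable) fun ε hε => ?_
  -- On {|Y|^p ≥ K} one has K |Y|^p ≤ |Y|^(2p), whose integral is at most C ≤ K ε. The added 1 keeps
  -- K nonzero for the final cancellation.
  set K : ℝ≥0 := C.toNNReal / ε.toNNReal + 1 with hKdef
  have hε' : ε.toNNReal ≠ 0 := (Real.toNNReal_pos.2 hε).ne'
  have hK0 : (K : ℝ≥0∞) ≠ 0 := by simp [hKdef]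
  have hCK : C ≤ K * ENNReal.ofReal ε := by
    rw [← ENNReal.coe_toNNReal hC, ENNReal.ofReal, ← ENNReal.coe_mul, ENNReal.coe_le_coe, hKdef,
      add_mul, div_mul_cancel₀ _ hε']
    exact le_self_add
  refine ⟨K, fun i => ?_⟩
  rw [eLpNorm_one_eq_lintegral_enorm]
  have h1 : (K : ℝ≥0∞) * ∫⁻ ω, ‖{ω | K ≤ ‖|Y i ω| ^ p‖₊}.indicator
      (fun ω => |Y i ω| ^ p) ω‖ₑ ∂P ≤ C := by
    rw [← lintegral_const_mul' _ _ ENNReal.coe_ne_top]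
    refine (lintegral_mono fun ω => ?_).trans (h i)
    by_cases hω : ω ∈ {ω | K ≤ ‖|Y i ω| ^ p‖₊}
    · rw [Set.indicator_of_mem hω, enorm_abs_rpow _ hp0, two_mul,
        ENNReal.rpow_add_of_nonneg _ _ hp0 hp0, ← enorm_abs_rpow _ hp0]
      gcongr
      exact ENNReal.coe_le_coe.2 hω
    · rw [Set.indicator_of_notMem hω]; simp
  have h2 := h1.trans hCK
  rwa [ENNReal.mul_le_mul_iff_right hK0 ENNReal.coe_ne_top] at h2

lemma MomentBounded.exists_measure_abs_gt_le {Y : ι → Ω → ℝ} (hY : MomentBounded P Y) {ε : ℝ}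
    (hε : 0 < ε) : ∃ C : ℝ, ∀ i, P {ω | C < |Y i ω|} ≤ ENNReal.ofReal ε := by
  obtain ⟨C, hC, h⟩ := hY.2 1 le_rfl
  set K : ℝ≥0 := C.toNNReal / ε.toNNReal + 1 with hKdef
  have hε' : ε.toNNReal ≠ 0 := (Real.toNNReal_pos.2 hε).ne'
  have hK0 : (K : ℝ≥0∞) ≠ 0 := by simp [hKdef]
  have hCK : C ≤ K * ENNReal.ofReal ε := by
    rw [← ENNReal.coe_toNNReal hC, ENNReal.ofReal, ← ENNReal.coe_mul, ENNReal.coe_le_coe, hKdef,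
      add_mul, div_mul_cancel₀ _ hε']
    exact le_self_add
  refine ⟨K, fun i => ?_⟩
  have h1 := mul_meas_ge_le_lintegral₀ (hY.1 i).enorm K
  have h2 := h i
  simp only [ENNReal.rpow_one] at h2
  have h3 := (h1.trans h2).trans hCK
  rw [ENNReal.mul_le_mul_iff_right hK0 ENNReal.coe_ne_top] at h3
  refine (measure_mono fun ω hω => ?_).trans h3
  have hω' : (K : ℝ) < |Y i ω| := hω
  rw [Set.mem_ofPred_eq, Real.enorm_eq_ofReal_abs, ← ENNReal.ofReal_coe_nnreal]
  exact ENNReal.ofReal_le_ofReal hω'.le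

lemma MomentBounded.tendstoInMeasure_inv_sqrt_mul {Z : ℕ → Ω → ℝ} (hZ : MomentBounded P Z) :
    TendstoInMeasure P (fun (n : ℕ) ω => (√(n : ℝ))⁻¹ * Z n ω) atTop (fun _ => (0 : ℝ)) := by
  obtain ⟨C, hC, h⟩ := hZ.2 1 le_rfl
  simp only [ENNReal.rpow_one] at h
  refine tendstoInMeasure_of_tendsto_eLpNorm one_ne_zero
    (fun n => ((hZ.1 n).const_mul _).aestronglyMeasurable) aestronglyMeasurable_const ?_
  have hlim : Tendsto (fun n : ℕ => ENNReal.ofReal (√(n : ℝ))⁻¹ * C) atTop (nhds 0) := by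
    have h1 : Tendsto (fun n : ℕ => (√(n : ℝ))⁻¹) atTop (nhds 0) :=
      (Real.tendsto_sqrt_atTop.comp tendsto_natCast_atTop_atTop).inv_tendsto_atTop
    have h2 := ENNReal.Tendsto.mul_const (ENNReal.tendsto_ofReal h1) (Or.inr hC)
    simpa using h2
  refine tendsto_of_tendsto_of_tendsto_of_le_of_le tendsto_const_nhds hlim (fun _ => zero_le)
    fun n => ?_
  simp only [eLpNorm_one_eq_lintegral_enorm, Pi.sub_apply, sub_zero, enorm_mul]
  rw [lintegral_const_mul' _ _ enorm_ne_top, Real.enorm_eq_ofReal (by positivity)]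
  gcongr
  exact h n

lemma lintegral_enorm_rpow_le {ν : Measure ℝ} {f : ℝ → ℝ} (hf : AEStronglyMeasurable f ν) {p : ℝ}
    (hp : 1 ≤ p) : (∫⁻ t, ‖f t‖ₑ ∂ν) ^ p ≤ ν Set.univ ^ (p - 1) * ∫⁻ t, ‖f t‖ₑ ^ p ∂ν := by
  have hp0 : 0 < p := by linarith
  have h := eLpNorm'_le_eLpNorm'_mul_rpow_measure_univ one_pos hp hf
  simp only [eLpNorm', ENNReal.rpow_one, div_one] at h
  have h2 := ENNReal.rpow_le_rpow h hp0.le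
  rw [ENNReal.mul_rpow_of_nonneg _ _ hp0.le, ← ENNReal.rpow_mul, ← ENNReal.rpow_mul,
    one_div_mul_cancel hp0.ne', ENNReal.rpow_one, sub_mul, one_div_mul_cancel hp0.ne', one_mul,
    mul_comm] at h2
  exact h2

/-- Integration over a bounded interval preserves uniform moment bounds. -/
lemma MomentBounded.intervalIntegral [SFinite P] {T : ℝ} (hT : 0 < T) {F : ι → Ω → ℝ → ℝ}
    {V : ι → ℝ → Ω → ℝ}
    (hF : ∀ i, AEStronglyMeasurable (Function.uncurry (F i))
      (P.prod (volume.restrict (Set.Ioc (-T) T))))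
    (hV : MomentBounded P (fun (j : ι × Set.Icc (-T) T) => V j.1 j.2))
    (hFV : ∀ i ω, ∀ t ∈ Set.Icc (-T) T, |F i ω t| ≤ |V i t ω|) :
    MomentBounded P (fun i ω => ∫ t in (-T)..T, F i ω t) := by
  have hle : -T ≤ T := by linarith
  simp only [intervalIntegral.integral_of_le hle]
  refine ⟨fun i => (hF i).integral_prod_right'.aemeasurable, fun p hp => ?_⟩
  have hp0 : 0 ≤ p := by linarith
  obtain ⟨C, hC, h⟩ := hV.2 p hp
  set ν := (volume : Measure ℝ).restrict (Set.Ioc (-T) T) with hν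
  have hνtop : ν Set.univ ≠ ∞ := by simp [hν]
  have hνp : ν Set.univ ^ (p - 1) ≠ ∞ := ENNReal.rpow_ne_top_of_nonneg (by linarith) hνtop
  refine ⟨ν Set.univ ^ (p - 1) * (C * ν Set.univ),
    ENNReal.mul_ne_top hνp (ENNReal.mul_ne_top hC hνtop), fun i => ?_⟩
  -- Jensen in t followed by Tonelli: moment bounds at each fixed t suffice, without a supremum over
  -- t inside the expectation.
  calc ∫⁻ ω, ‖∫ t, F i ω t ∂ν‖ₑ ^ p ∂P
      ≤ ∫⁻ ω, ν Set.univ ^ (p - 1) * ∫⁻ t, ‖F i ω t‖ₑ ^ p ∂ν ∂P := by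
        refine lintegral_mono_ae ?_
        filter_upwards [(hF i).prodMk_left] with ω hω
        refine le_trans ?_ (lintegral_enorm_rpow_le hω hp)
        exact ENNReal.rpow_le_rpow (enorm_integral_le_lintegral_enorm _) hp0
    _ = ν Set.univ ^ (p - 1) * ∫⁻ t, ∫⁻ ω, ‖F i ω t‖ₑ ^ p ∂P ∂ν := by
        rw [lintegral_const_mul' _ _ hνp, lintegral_lintegral_swap]
        exact (hF i).enorm.pow_const p
    _ ≤ ν Set.univ ^ (p - 1) * ∫⁻ t, C ∂ν := by
        refine mul_le_mul_right (lintegral_mono_ae ?_) _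
        filter_upwards [ae_restrict_mem measurableSet_Ioc] with t ht
        have ht' : t ∈ Set.Icc (-T) T := Set.Ioc_subset_Icc_self ht
        refine (lintegral_mono fun ω => ?_).trans (h (i, ⟨t, ht'⟩))
        have : ‖F i ω t‖ₑ ≤ ‖V i t ω‖ₑ := enorm_le_iff_norm_le.2 (hFV i ω t ht')
        gcongr
    _ = _ := by rw [lintegral_const]

end Consequences

/-! ### Uniform moment bounds for U_n. -/

section StandardizedDeviation

variable {Ω : Type*} [MeasurableSpace Ω] {P : Measure Ω}

lemma normalizedSum_eq {Ω : Type*} {n : ℕ} (hn : n ≠ 0) (Z : ℕ → Ω → ℝ) (g : ℝ → ℝ) (ω : Ω) :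
    √(n : ℝ) * ((1 / (n : ℝ)) * ∑ k, g (sample Z n ω k)) = normalizedSum Z g n ω := by
  have hs : √(n : ℝ) ≠ 0 := Real.sqrt_ne_zero'.2 (by exact_mod_cast Nat.pos_of_ne_zero hn)
  have h : ∑ k, g (sample Z n ω k) = ∑ k ∈ Finset.range n, g (Z k ω) :=
    Fin.sum_univ_eq_sum_range (fun k => g (Z k ω)) n
  rw [normalizedSum, h, ← mul_assoc]
  congr 1
  rw [mul_one_div, div_eq_iff (by exact_mod_cast hn)]
  nth_rw 3 [← Real.mul_self_sqrt (Nat.cast_nonneg n)]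
  field_simp

lemma norm_scaledDeviation_le {Ω : Type*} (Z : ℕ → Ω → ℝ) {T t : ℝ} (ht : |t| ≤ T) (n : ℕ) (ω : Ω) :
    ‖scaledDeviation (sample Z n ω) t‖ ≤
      |normalizedSum Z (fun z => Real.cos (t * z) - psi0 t) n ω| +
      |normalizedSum Z (fun z => Real.sin (t * z)) n ω| +
      T * (|normalizedSum Z (fun z => z ^ 2 - 1) n ω| + normalizedSum Z id n ω ^ 2 +
        |normalizedSum Z id n ω|) := by
  have hT0 : 0 ≤ T := (abs_nonneg t).trans ht
  rcases eq_or_ne n 0 with rfl | hn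
  · rw [norm_scaledDeviation]
    simp only [Nat.cast_zero, Real.sqrt_zero, zero_mul]
    positivity
  set z := sample Z n ω with hz
  have e1 := normalizedSum_eq hn Z (fun z => Real.cos (t * z) - psi0 t) ω
  have e2 := normalizedSum_eq hn Z (fun z => Real.sin (t * z)) ω
  have e3 := normalizedSum_eq hn Z (fun z => z ^ 2 - 1) ω
  have e4 := normalizedSum_eq hn Z id ω
  simp only [id] at e4
  have e4' : √(n : ℝ) * sampleMean z = normalizedSum Z id n ω := e4
  rw [← e1, ← e2, ← e3, ← e4', norm_scaledDeviation, ← hz]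
  have hs : 1 ≤ √(n : ℝ) := Real.one_le_sqrt.2 (by exact_mod_cast Nat.pos_of_ne_zero hn)
  have hs0 : 0 ≤ √(n : ℝ) := by linarith
  have i1 := norm_stdEcf_sub_ecf_le hn z t
  have i2 := abs_sampleSD_sub_one_le hn z
  have i3 := norm_ecf_sub_psi0_le hn z t
  have i4 : ‖stdEcf z t - (psi0 t : ℂ)‖ ≤
      |(1 / (n : ℝ)) * ∑ k, (Real.cos (t * z k) - psi0 t)| +
      |(1 / (n : ℝ)) * ∑ k, Real.sin (t * z k)| +
      T * (|(1 / (n : ℝ)) * ∑ k, (z k ^ 2 - 1)| + sampleMean z ^ 2 + |sampleMean z|) := by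
    refine (norm_sub_le_norm_sub_add_norm_sub _ (ecf z t) _).trans ?_
    rw [add_comm]
    refine add_le_add i3 (i1.trans ?_)
    gcongr
  simp only [abs_mul √(n : ℝ), abs_of_nonneg hs0, mul_pow]
  generalize |(1 / (n : ℝ)) * ∑ k, (Real.cos (t * z k) - psi0 t)| = A at *
  generalize |(1 / (n : ℝ)) * ∑ k, Real.sin (t * z k)| = B at *
  generalize |(1 / (n : ℝ)) * ∑ k, (z k ^ 2 - 1)| = D at *
  generalize sampleMean z = M at *
  generalize √(n : ℝ) = s at *
  calc s * ‖stdEcf z t - (psi0 t : ℂ)‖ ≤ s * (A + B + T * (D + M ^ 2 + |M|)) := by gcongr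
    _ = s * A + s * B + T * (s * D + s * M ^ 2 + s * |M|) := by ring
    -- As √n ≥ 1, √n M² ≤ (√n M)².
    _ ≤ _ := by gcongr; exact le_self_pow₀ hs two_ne_zero

lemma momentBounded_scaledDeviation_standard [IsProbabilityMeasure P] {Z : ℕ → Ω → ℝ}
    (hindep : iIndepFun Z P) (hlaw : ∀ k, HasLaw (Z k) (gaussianReal 0 1) P) (T : ℝ) :
    MomentBounded P (fun (j : ℕ × Set.Icc (-T) T) ω =>
      ‖scaledDeviation (sample Z j.1 ω) (j.2 : ℝ)‖) := by
  have b1 := momentBounded_normalizedSum (ι := Set.Icc (-T) T) hindep hlaw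
    (g := fun t z => Real.cos (t * z) - psi0 t) (c := 2) (fun t => by fun_prop)
    (fun t z => by
      have h1 := Real.abs_cos_le_one (t * z)
      have h2 := psi0_pos t
      have h3 := psi0_le_one t
      rw [abs_le] at h1 ⊢
      constructor <;> nlinarith [sq_nonneg z])
    (fun t => integral_cos_sub_stdGaussian t)
  have b2 := momentBounded_normalizedSum (ι := Set.Icc (-T) T) hindep hlaw
    (g := fun t z => Real.sin (t * z)) (c := 1) (fun t => by fun_prop)
    (fun t z => by nlinarith [Real.abs_sin_le_one (t * z), sq_nonneg z])
    (fun t => integral_sin_stdGaussian t)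
  have b3 := momentBounded_normalizedSum (ι := Set.Icc (-T) T) hindep hlaw
    (g := fun _ z => z ^ 2 - 1) (c := 1) (fun t => by fun_prop)
    (fun t z => by rw [abs_le]; constructor <;> nlinarith [sq_nonneg z])
    (fun t => integral_sq_sub_one_stdGaussian)
  have b4 := momentBounded_normalizedSum (ι := Set.Icc (-T) T) hindep hlaw
    (g := fun _ => id) (c := 1) (fun t => measurable_id)
    (fun t z => by
      simp only [id]
      rw [abs_le]; constructor <;> nlinarith [sq_nonneg (z - 1), sq_nonneg (z + 1)])
    (fun t => integral_id_stdGaussian)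
  refine ((b1.abs.add b2.abs).add (((b3.abs.add (b4.pow one_le_two)).add b4.abs).const_mul T)).mono
    (fun j => ?_) fun j ω => ?_
  · have hs : AEMeasurable (fun ω => sample Z j.1 ω) P :=
      aemeasurable_pi_lambda _ fun k => (hlaw k).aemeasurable
    exact ((measurable_scaledDeviation j.1).comp_aemeasurable
      (hs.prodMk aemeasurable_const)).norm
  · rw [abs_of_nonneg (norm_nonneg _)]
    exact (norm_scaledDeviation_le Z (abs_le.2 j.2.2) j.1 ω).trans (le_abs_self _)

lemma momentBounded_scaledDeviation [IsProbabilityMeasure P] {X : ℕ → Ω → ℝ} {μ : ℝ} {σ : ℝ≥0}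
    (hσ : 0 < σ) (hindep : iIndepFun X P)
    (hlaw : ∀ k, HasLaw (X k) (gaussianReal μ (σ ^ 2)) P) (T : ℝ) :
    MomentBounded P (fun (j : ℕ × Set.Icc (-T) T) ω =>
      ‖scaledDeviation (sample X j.1 ω) (j.2 : ℝ)‖) := by
  have hσ' : (0 : ℝ) < σ := hσ
  let Z : ℕ → Ω → ℝ := fun k ω => (σ : ℝ)⁻¹ * (X k ω - μ)
  have hZ : iIndepFun Z P := hindep.comp (fun _ x => (σ : ℝ)⁻¹ * (x - μ)) fun _ => by fun_prop
  have hZlaw : ∀ k, HasLaw (Z k) (gaussianReal 0 1) P := fun k => by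
    have h := gaussianReal_const_mul (gaussianReal_sub_const (hlaw k) μ) (σ : ℝ)⁻¹
    have e : (NNReal.mk ((σ : ℝ)⁻¹ ^ 2) (sq_nonneg _) * σ ^ 2 : ℝ≥0) = 1 := by
      ext
      push_cast
      field_simp
    rwa [e, sub_self, mul_zero] at h
  have hX : ∀ n ω, sample X n ω = fun k => μ + σ * sample Z n ω k := fun n ω => by
    ext k
    simp only [sample, Z]
    field_simp
    ring
  have hU : ∀ n ω t, scaledDeviation (sample X n ω) t = scaledDeviation (sample Z n ω) t :=
    fun n ω t => by rw [scaledDeviation, scaledDeviation, hX, stdEcf_affine _ _ hσ']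
  simp only [hU]
  exact momentBounded_scaledDeviation_standard hZ hZlaw T

lemma div_mem_Icc {T t c : ℝ} (hc : 1 ≤ c) (ht : t ∈ Set.Icc (-T) T) :
    t / c ∈ Set.Icc (-T) T := by
  rw [Set.mem_Icc, ← abs_le] at ht ⊢
  rw [abs_div, abs_of_pos (by linarith : 0 < c)]
  exact (div_le_self (abs_nonneg t) hc).trans ht

lemma momentBounded_deviationNorm [IsProbabilityMeasure P] {X : ℕ → Ω → ℝ} {μ : ℝ} {σ : ℝ≥0}
    (hσ : 0 < σ) (hindep : iIndepFun X P)
    (hlaw : ∀ k, HasLaw (X k) (gaussianReal μ (σ ^ 2)) P) (T : ℝ) {m : ℕ} (hm : 1 ≤ m) :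
    MomentBounded P (fun (j : ℕ × Set.Icc (-T) T) ω =>
      deviationNorm (sample X j.1 ω) m (j.2 : ℝ)) := by
  have h := momentBounded_scaledDeviation hσ hindep hlaw T
  have hm' : (1 : ℝ) ≤ m := by exact_mod_cast hm
  have c1 : 1 ≤ √((m : ℝ) + 1) := Real.one_le_sqrt.2 (by linarith)
  have c2 : 1 ≤ √(m : ℝ) := Real.one_le_sqrt.2 hm'
  exact (h.comp_index fun j : ℕ × Set.Icc (-T) T => (j.1, ⟨_, div_mem_Icc c1 j.2.2⟩)).add
    (h.comp_index fun j : ℕ × Set.Icc (-T) T => (j.1, ⟨_, div_mem_Icc c2 j.2.2⟩))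

end StandardizedDeviation

/-! ### Moments of n Δ_m and of the linearization error. -/

section Discrepancy

variable {Ω : Type*} [MeasurableSpace Ω] {P : Measure Ω} {X : ℕ → Ω → ℝ} {μ : ℝ} {σ : ℝ≥0} {T : ℝ} {w : ℝ → ℝ} {m : ℕ}

lemma aestronglyMeasurable_weight_mul_sample [SFinite P] (hX : ∀ k, AEMeasurable (X k) P)
    (hw : AEMeasurable w (volume.restrict (Set.Icc (-T) T))) {n : ℕ} {G : (Fin n → ℝ) × ℝ → ℝ}
    (hG : Measurable G) :
    AEStronglyMeasurable (Function.uncurry fun ω t => w t * G (sample X n ω, t))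
      (P.prod (volume.restrict (Set.Ioc (-T) T))) := by
  have hs : AEMeasurable (fun ω => sample X n ω) P := aemeasurable_pi_lambda _ fun k => hX k
  have hw' : AEMeasurable w (volume.restrict (Set.Ioc (-T) T)) :=
    hw.mono_measure (Measure.restrict_mono Set.Ioc_subset_Icc_self le_rfl)
  exact (hw'.comp_snd.mul
    (hG.comp_aemeasurable (hs.comp_fst.prodMk measurable_snd.aemeasurable))).aestronglyMeasurable

lemma intervalIntegrable_weight_mul (hT : 0 < T)
    (hw : AEMeasurable w (volume.restrict (Set.Icc (-T) T))) {B : ℝ}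
    (hB : ∀ t ∈ Set.Icc (-T) T, |w t| ≤ B) {f : ℝ → ℝ} (hf : Continuous f) :
    IntervalIntegrable (fun t => w t * f t) volume (-T) T := by
  rw [intervalIntegrable_iff_integrableOn_Icc_of_le (by linarith)]
  refine Integrable.bdd_mul (c := B) (hf.continuousOn.integrableOn_compact isCompact_Icc)
    hw.aestronglyMeasurable ?_
  filter_upwards [ae_restrict_mem measurableSet_Icc] with t ht using hB t ht

lemma momentBounded_natCast_mul_discrepancyMeasure [IsProbabilityMeasure P] (hσ : 0 < σ)
    (hindep : iIndepFun X P)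
    (hlaw : ∀ k, HasLaw (X k) (gaussianReal μ (σ ^ 2)) P) (hT : 0 < T)
    (hw : AEMeasurable w (volume.restrict (Set.Icc (-T) T))) {B : ℝ}
    (hB : ∀ t ∈ Set.Icc (-T) T, |w t| ≤ B) (hm : 1 ≤ m) :
    MomentBounded P (fun (n : ℕ) ω => (n : ℝ) * discrepancyMeasure w T m (sample X n ω)) := by
  have hV := ((momentBounded_deviationNorm hσ hindep hlaw T hm).pow one_le_two).const_mul
    (B * (m + 1) ^ 2)
  have h := MomentBounded.intervalIntegral (ι := ℕ) hT
    (F := fun n ω t => w t * ((n : ℝ) * ‖iterDiscrepancy m (sample X n ω) t‖ ^ 2))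
    (V := fun n t ω => B * (m + 1) ^ 2 * deviationNorm (sample X n ω) m t ^ 2)
    (fun n => aestronglyMeasurable_weight_mul_sample (fun k => (hlaw k).aemeasurable) hw
      (G := fun q => (n : ℝ) * ‖iterDiscrepancy m q.1 q.2‖ ^ 2)
      (((measurable_iterDiscrepancy n m).norm.pow_const 2).const_mul _)) hV
    (fun n ω t ht => by
      have h1 := natCast_mul_norm_sq_iterDiscrepancy_le (sample X n ω) (by omega : m ≠ 0) t
      refine le_trans ?_ (le_abs_self _)
      rw [abs_mul, mul_assoc, abs_of_nonneg (by positivity :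
        0 ≤ (n : ℝ) * ‖iterDiscrepancy m (sample X n ω) t‖ ^ 2)]
      have hB0 : 0 ≤ B := (abs_nonneg _).trans (hB t ht)
      gcongr
      exact hB t ht)
  refine h.mono (fun n => ?_) fun n ω => le_of_eq ?_
  · refine (h.1 n).congr (ae_of_all _ fun ω => ?_)
    simp only [discrepancyMeasure, ← intervalIntegral.integral_const_mul, mul_left_comm]
  · simp only [discrepancyMeasure, ← intervalIntegral.integral_const_mul, mul_left_comm]

lemma momentBounded_linearization_error [IsProbabilityMeasure P] (hσ : 0 < σ)
    (hindep : iIndepFun X P)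
    (hlaw : ∀ k, HasLaw (X k) (gaussianReal μ (σ ^ 2)) P) (hT : 0 < T)
    (hw : AEMeasurable w (volume.restrict (Set.Icc (-T) T))) {B : ℝ}
    (hB : ∀ t ∈ Set.Icc (-T) T, |w t| ≤ B) (hm : 1 ≤ m) :
    MomentBounded P (fun (n : ℕ) ω => ∫ t in (-T)..T, w t * (√(n : ℝ) *
      ((n : ℝ) * ‖iterDiscrepancy m (sample X n ω) t‖ ^ 2 -
        psi0 t ^ 2 * ‖transformedDeviation m (sample X n ω) t‖ ^ 2))) := by
  have hV := ((momentBounded_deviationNorm hσ hindep hlaw T hm).pow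
    (by norm_num : 1 ≤ 3)).const_mul (B * (2 * (m + 1) ^ 3))
  refine MomentBounded.intervalIntegral (ι := ℕ) hT
    (V := fun n t ω => B * (2 * (m + 1) ^ 3) * deviationNorm (sample X n ω) m t ^ 3)
    (fun n => aestronglyMeasurable_weight_mul_sample (fun k => (hlaw k).aemeasurable) hw
      (G := fun q => √(n : ℝ) * ((n : ℝ) * ‖iterDiscrepancy m q.1 q.2‖ ^ 2 -
        psi0 q.2 ^ 2 * ‖transformedDeviation m q.1 q.2‖ ^ 2)) ?_) hV
    (fun n ω t ht => ?_)
  · have h1 := (measurable_iterDiscrepancy n m).norm.pow_const 2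
    have h2 := (measurable_transformedDeviation n m).norm.pow_const 2
    have h3 : Measurable fun q : (Fin n → ℝ) × ℝ => psi0 q.2 ^ 2 :=
      (continuous_psi0.measurable.comp measurable_snd).pow_const 2
    exact ((h1.const_mul _).sub (h3.mul h2)).const_mul _
  · have h1 := sqrt_mul_abs_sub_le (sample X n ω) (by omega : m ≠ 0) t
    refine le_trans ?_ (le_abs_self _)
    rw [abs_mul, mul_assoc, abs_mul √(n : ℝ), abs_of_nonneg (Real.sqrt_nonneg _)]
    have hB0 : 0 ≤ B := (abs_nonneg _).trans (hB t ht)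
    gcongr
    exact hB t ht

/-- Isolates the factor 1/√n in front of a moment-bounded family, which yields convergence in
probability. At n = 0 both sides are 0 by the division conventions. -/
lemma discrepancyMeasure_sub_div_inv (hT : 0 < T)
    (hw : AEMeasurable w (volume.restrict (Set.Icc (-T) T))) {B : ℝ}
    (hB : ∀ t ∈ Set.Icc (-T) T, |w t| ≤ B) {n : ℕ} (x : Fin n → ℝ) :
    (discrepancyMeasure w T m x - (1 / (n : ℝ)) *
        ∫ t in (-T)..T, w t * psi0 t ^ 2 * ‖transformedDeviation m x t‖ ^ 2) / (n : ℝ)⁻¹ =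
      (√(n : ℝ))⁻¹ * ∫ t in (-T)..T, w t * (√(n : ℝ) * ((n : ℝ) * ‖iterDiscrepancy m x t‖ ^ 2 -
        psi0 t ^ 2 * ‖transformedDeviation m x t‖ ^ 2)) := by
  rcases eq_or_ne n 0 with rfl | hn
  · simp
  have hn' : (n : ℝ) ≠ 0 := by exact_mod_cast hn
  have hs : √(n : ℝ) ≠ 0 := Real.sqrt_ne_zero'.2 (by exact_mod_cast Nat.pos_of_ne_zero hn)
  have h1 := continuous_iterDiscrepancy x m
  have h2 := continuous_transformedDeviation x m
  have h3 := continuous_psi0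
  have i1 := intervalIntegrable_weight_mul hT hw hB
    (f := fun t => ‖iterDiscrepancy m x t‖ ^ 2) (by fun_prop)
  have i2 := intervalIntegrable_weight_mul hT hw hB
    (f := fun t => psi0 t ^ 2 * ‖transformedDeviation m x t‖ ^ 2) (by fun_prop)
  have e : ∀ t, w t * (√(n : ℝ) * ((n : ℝ) * ‖iterDiscrepancy m x t‖ ^ 2 -
      psi0 t ^ 2 * ‖transformedDeviation m x t‖ ^ 2)) =
      √(n : ℝ) * ((n : ℝ) * (w t * ‖iterDiscrepancy m x t‖ ^ 2) -
        w t * (psi0 t ^ 2 * ‖transformedDeviation m x t‖ ^ 2)) := fun t => by ring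
  simp only [e, discrepancyMeasure, mul_assoc]
  rw [intervalIntegral.integral_const_mul, intervalIntegral.integral_sub (i1.const_mul _) i2,
    intervalIntegral.integral_const_mul]
  field_simp

end Discrepancy

end SSTN

theorem mainTheorem4
    {Ω : Type*} [MeasurableSpace Ω] (P : MeasureTheory.Measure Ω)
    [MeasureTheory.IsProbabilityMeasure P]
    (X : ℕ → Ω → ℝ) (μ : ℝ) (σ : NNReal) (hσ : 0 < σ)
    (hindep : ProbabilityTheory.iIndepFun X P)
    (hlaw : ∀ k, ProbabilityTheory.HasLaw (X k) (ProbabilityTheory.gaussianReal μ (σ ^ 2)) P)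
    (T : ℝ) (hT : 0 < T)
    (w : ℝ → ℝ)
    (hwmeas : AEMeasurable w (MeasureTheory.volume.restrict (Set.Icc (-T) T)))
    (hwbdd : ∃ B : ℝ, ∀ t ∈ Set.Icc (-T) T, |w t| ≤ B)
    (m : ℕ) (hm : 1 ≤ m) :
    -- the asymptotic expansion
    SSTN.IsLittleOP P
      (fun n ω => SSTN.discrepancyMeasure w T m (SSTN.sample X n ω) -
        (1 / (n : ℝ)) * ∫ t in (-T)..T, w t * SSTN.psi0 t ^ 2 *
          ‖SSTN.transformedDeviation m (SSTN.sample X n ω) t‖ ^ 2)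
      (fun n => (n : ℝ)⁻¹) ∧
    -- the order of magnitude in probability
    SSTN.IsBigOP P
      (fun n ω => SSTN.discrepancyMeasure w T m (SSTN.sample X n ω))
      (fun n => (n : ℝ)⁻¹) ∧
    -- moment bounds and uniform integrability; the absolute value is redundant when `0 ≤ w`
    (∀ p : ℝ, 1 ≤ p →
      (⨆ n : ℕ, ∫⁻ ω, ENNReal.ofReal
        (|(n : ℝ) * SSTN.discrepancyMeasure w T m (SSTN.sample X n ω)| ^ p) ∂P) < ⊤ ∧
      MeasureTheory.UniformIntegrable
        (fun (n : ℕ) ω =>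
          |(n : ℝ) * SSTN.discrepancyMeasure w T m (SSTN.sample X n ω)| ^ p) 1 P) := by
  obtain ⟨B, hB⟩ := hwbdd
  have hD := SSTN.momentBounded_natCast_mul_discrepancyMeasure hσ hindep hlaw hT hwmeas hB hm
  have hE := SSTN.momentBounded_linearization_error hσ hindep hlaw hT hwmeas hB hm
  refine ⟨?_, fun ε hε => ?_, fun p hp => ⟨hD.iSup_lintegral_lt_top hp, hD.uniformIntegrable hp⟩⟩
  · unfold SSTN.IsLittleOP
    simp only [SSTN.discrepancyMeasure_sub_div_inv hT hwmeas hB]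
    exact hE.tendstoInMeasure_inv_sqrt_mul
  · obtain ⟨C, hC⟩ := hD.exists_measure_abs_gt_le hε
    refine ⟨C, 0, fun n _ => ?_⟩
    simp only [div_inv_eq_mul, mul_comm _ (n : ℝ)]
    exact hC n
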